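/- Let $n\ge 1$ be an integer, let $\mathbb B_n=\{z\in\mathbb C^n:|z|<1\}$, let $\langle z,u\rangle=\sum_{k=1}^n z_k\overline{u_k}$ and $|z|=\langle z,z\rangle^{1/2}$, and let $\upsilon$ be the volume measure on $\mathbb B_n$ normalized so that $\upsilon(\mathbb B_n)=1$. For $\theta>-1$ put $$d\upsilon_\theta(z)=\frac{\Gamma(n+\theta+1)}{n!\,\Gamma(\theta+1)}(1-|z|^2)^\theta\,d\upsilon(z).$$ For $\vec p=(p_1,p_2)\in[1,\infty)^2$ and $\vec\alpha=(\alpha_1,\alpha_2)\in(-1,\infty)^2$, let $L^{\vec p}_{\vec\alpha}$ be the space of measurable $f:\mathbb B_n\times\mathbb B_n\to\mathbb C$ with $$\|f\|_{L^{\vec p}_{\vec\alpha}}=\left\{\int_{\mathbb B_n}\left[\int_{\mathbb B_n}|f(z,w)|^{p_1}\,d\upsilon_{\alpha_1}(z)\right]^{p_2/p_1}d\upsilon_{\alpha_2}(w)\right\}^{1/p_2}<\infty .$$ For $\vec a,\vec b,\vec c\in\mathbb R^2$ define $$T_{\vec a,\vec b,\vec c}f(z,w)=(1-|z|^2)^{a_1}(1-|w|^2)^{a_2}\int_{\mathbb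 B_n}\int_{\mathbb B_n}\frac{(1-|u|^2)^{b_1}(1-|\eta|^2)^{b_2}}{(1-\langle z,u\rangle)^{c_1}(1-\langle w,\eta\rangle)^{c_2}}f(u,\eta)\,d\upsilon(u)\,d\upsilon(\eta)$$ (principal powers), and $$S_{\vec a,\vec b,\vec c}f(z,w)=(1-|z|^2)^{a_1}(1-|w|^2)^{a_2}\int_{\mathbb B_n}\int_{\mathbb B_n}\frac{(1-|u|^2)^{b_1}(1-|\eta|^2)^{b_2}}{|1-\langle z,u\rangle|^{c_1}|1-\langle w,\eta\rangle|^{c_2}}f(u,\eta)\,d\upsilon(u)\,d\upsilon(\eta).$$ Such an operator is called bounded from $L^{\vec p}_{\vec\alpha}$ to $L^{\vec q}_{\vec\beta}$ if there is a constant $C<\infty$ such that, for every $f\in L^{\vec p}_{\vec\alpha}$, the defining double integral converges absolutely for almost every $(z,w)$, and the resulting function belongs to $L^{\vec q}_{\vec\beta}$ with norm at most $C\|f\|_{L^{\vec p}_{\vec\alpha}}$. **Theorem 1.1.** Let $\vec a,\vec b,\vec c\in\mathbb R^2$, let $\vec\alpha,\vec\beta\in(-1,\infty)^2$, and let $\vec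 p=(p_1,p_2)$, $\vec q=(q_1,q_2)$ satisfy $1<\min\{p_1,p_2\}$ and $\max\{p_1,p_2\}\le\min\{q_1,q_2\}<\infty$, with all $p_i,q_i$ finite. Then the following statements are equivalent. (i) $S_{\vec a,\vec b,\vec c}$ is bounded from $L^{\vec p}_{\vec\alpha}$ to $L^{\vec q}_{\vec\beta}$. (ii) $T_{\vec a,\vec b,\vec c}$ is bounded from $L^{\vec p}_{\vec\alpha}$ to $L^{\vec q}_{\vec\beta}$. (iii) For each $i\in\{1,2\}$, $$-q_ia_i<\beta_i+1,\qquad \alpha_i+1<p_i(b_i+1),\qquad c_i\le n+1+a_i+b_i+\frac{n+1+\beta_i}{q_i}-\frac{n+1+\alpha_i}{p_i}.$$ -/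

import Mathlib

open MeasureTheory
open scoped ENNReal NNReal

namespace ForelliRudin

noncomputable section

/-- The space `ℂⁿ` with its Hermitian inner product and Euclidean norm. -/
abbrev Cn (n : ℕ) : Type := EuclideanSpace ℂ (Fin n)

/-- The volume measure on the open unit ball of `ℂⁿ`, normalized to total mass one
(as a measure on `ℂⁿ` that is carried by the ball). -/
def normVol (n : ℕ) : Measure (Cn n) :=
  (volume (Metric.ball (0 : Cn n) 1))⁻¹ • volume.restrict (Metric.ball (0 : Cn n) 1)

/-- The constant `c_θ = Γ(n + θ + 1) / (n! Γ(θ + 1))`. -/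
def weightConst (n : ℕ) (θ : ℝ) : ℝ :=
  Real.Gamma (n + θ + 1) / ((n.factorial : ℝ) * Real.Gamma (θ + 1))

/-- The weighted measure `dυ_θ(z) = c_θ (1 - |z|²)^θ dυ(z)` on the ball. -/
def weightedVol (n : ℕ) (θ : ℝ) : Measure (Cn n) :=
  (normVol n).withDensity fun z => ENNReal.ofReal (weightConst n θ * (1 - ‖z‖ ^ 2) ^ θ)

/-- The mixed norm
`{∫ [∫ |f(z,w)|^{p₁} dυ_{α₁}(z)]^{p₂/p₁} dυ_{α₂}(w)}^{1/p₂}`, with values in `[0, ∞]`,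
for exponents `p₁, p₂ ∈ (0, ∞)`. The coordinates of a pair are indexed by `0, 1 : Fin 2`. -/
def mixedNorm {n : ℕ} (p α : Fin 2 → ℝ) (f : Cn n × Cn n → ℂ) : ℝ≥0∞ :=
  (∫⁻ w, (∫⁻ z, ‖f (z, w)‖ₑ ^ p 0 ∂weightedVol n (α 0)) ^ (p 1 / p 0)
    ∂weightedVol n (α 1)) ^ (1 / p 1)

/-- Membership in the weighted mixed-norm Lebesgue space: `f` is (Lebesgue) measurable on the
product of the balls and has finite mixed norm. -/
def MemMixed {n : ℕ} (p α : Fin 2 → ℝ) (f : Cn n × Cn n → ℂ) : Prop :=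
  AEStronglyMeasurable f ((normVol n).prod (normVol n)) ∧ mixedNorm p α f < ∞

/-- The kernel `(1-|u|²)^{b₁} (1-|η|²)^{b₂} / ((1-⟨z,u⟩)^{c₁} (1-⟨w,η⟩)^{c₂})` at
`x = (z, w)`, `y = (u, η)`. Mathlib's inner product is conjugate-linear in its first argument, so
`⟨z, u⟩ = ∑ zᵢ conj(uᵢ)` is `inner ℂ u z`. The powers are principal ones. -/
def kernelT {n : ℕ} (b c : Fin 2 → ℝ) (x y : Cn n × Cn n) : ℂ :=
  (((1 - ‖y.1‖ ^ 2) ^ b 0 * (1 - ‖y.2‖ ^ 2) ^ b 1 : ℝ) : ℂ) /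
    ((1 - inner ℂ y.1 x.1) ^ (c 0 : ℂ) * (1 - inner ℂ y.2 x.2) ^ (c 1 : ℂ))

/-- The kernel `(1-|u|²)^{b₁} (1-|η|²)^{b₂} / (|1-⟨z,u⟩|^{c₁} |1-⟨w,η⟩|^{c₂})`. -/
def kernelS {n : ℕ} (b c : Fin 2 → ℝ) (x y : Cn n × Cn n) : ℂ :=
  (((1 - ‖y.1‖ ^ 2) ^ b 0 * (1 - ‖y.2‖ ^ 2) ^ b 1 /
    (‖1 - inner ℂ y.1 x.1‖ ^ c 0 * ‖1 - inner ℂ y.2 x.2‖ ^ c 1) : ℝ) : ℂ)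

/-- The operator
`f ↦ (1-|z|²)^{a₁} (1-|w|²)^{a₂} ∬ K((z,w),(u,η)) f(u,η) dυ(u) dυ(η)`. -/
def integralOp {n : ℕ} (a : Fin 2 → ℝ) (K : Cn n × Cn n → Cn n × Cn n → ℂ)
    (f : Cn n × Cn n → ℂ) (x : Cn n × Cn n) : ℂ :=
  (((1 - ‖x.1‖ ^ 2) ^ a 0 * (1 - ‖x.2‖ ^ 2) ^ a 1 : ℝ) : ℂ) *
    ∫ y, K x y * f y ∂(normVol n).prod (normVol n)

/-- Boundedness of `integralOp a K` from the mixed-norm space with exponents `p` and weights `α`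
to the one with exponents `q` and weights `β`: for every `f` in the first space the defining
integral converges absolutely at almost every point, the image lies in the second space, and its
norm is at most a constant, independent of `f`, times the norm of `f`. -/
def IsBoundedOp {n : ℕ} (a : Fin 2 → ℝ) (K : Cn n × Cn n → Cn n × Cn n → ℂ)
    (p α q β : Fin 2 → ℝ) : Prop :=
  ∃ C : ℝ≥0, ∀ f : Cn n × Cn n → ℂ, MemMixed p α f →
    (∀ᵐ x ∂(normVol n).prod (normVol n),
      Integrable (fun y => K x y * f y) ((normVol n).prod (normVol n))) ∧
    MemMixed q β (integralOp a K f) ∧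
    mixedNorm q β (integralOp a K f) ≤ C * mixedNorm p α f

/-- `T_{a,b,c}` is bounded from `L^p_α` to `L^q_β`. -/
def TBounded (n : ℕ) (a b c p α q β : Fin 2 → ℝ) : Prop :=
  IsBoundedOp (n := n) a (kernelT b c) p α q β

/-- `S_{a,b,c}` is bounded from `L^p_α` to `L^q_β`. -/
def SBounded (n : ℕ) (a b c p α q β : Fin 2 → ℝ) : Prop :=
  IsBoundedOp (n := n) a (kernelS b c) p α q β

end

end ForelliRudin

/-! The kernels of S and T have the same modulus, a product of one-variable kernels, and both have
real part at least a quarter of their modulus wherever 1 - ⟨z,u⟩ and 1 - ⟨w,η⟩ are relatively close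
to positive numbers. `IsNearlyPositiveKernel` records this, and `isBoundedOp_iff` shows for every
such kernel that boundedness is equivalent to (iii), so S and T are two instances of one statement.

Sufficiency. Taking absolute values leaves a positive operator with a product kernel. In one
variable it is handled by Schur's test (`lintegral_schur_test`) with a power of 1 - |z|² as
auxiliary function: split the kernel as k₁k₂, use Hölder against k₁, then Minkowski's integral
inequality with exponent q/p ≥ 1 for k₂. The two integrals to control are Forelli–Rudin integrals
(`exists_forelliRudin_le`). The first two conditions in (iii) leave room for the powers in the
splitting; the third puts c at or below the critical exponent, and smaller c costs only a constant
because |1 - ⟨z,u⟩| < 2. In two variables, apply the bound in z for fixed w, move the inner norm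
past the η-integral by Minkowski, and apply the bound in w.

The Forelli–Rudin estimate is a dyadic sum over the nonisotropic balls {|1 - ⟨z,u⟩| < R} with R ≥ 1
- |z|, whose weighted volume is O(R^(n+1+s)). Unweighted, a unitary change of basis places such a
ball in a box; the weight is brought in by comparing the two integrals on each ray.

Necessity. Test on products G₀(u)G₁(η) and look at the image only on sets F₀ × F₁ for which the
kernel is nearly positive; then nothing cancels, even for T. The resulting inequality factors
(`exists_testValue_mul_le`), and freezing one factor leaves a one-variable inequality,
`HasTestBound`. Three families of test data give the three conditions: G supported near 0 with F the
whole ball; F near 0 with G a power of 1 - |u|² on the whole ball; and F, the support of G, both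
equal to a nonisotropic box of size δ at distance about δ from the sphere, as δ → 0. -/

/-! ### Polar coordinates and Minkowski's integral inequality -/

/-- Integration in polar coordinates for nonnegative functions. -/
theorem lintegral_polarCoord_addHaar {E : Type*} [NormedAddCommGroup E] [NormedSpace ℝ E]
    [MeasurableSpace E] [BorelSpace E] [FiniteDimensional ℝ E] [Nontrivial E]
    (μ : Measure E) [μ.IsAddHaarMeasure] {f : E → ℝ≥0∞} (hf : Measurable f) :
    ∫⁻ x, f x ∂μ = ∫⁻ ζ : Metric.sphere (0 : E) 1, (∫⁻ r in Set.Ioi (0 : ℝ),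
      ENNReal.ofReal (r ^ (Module.finrank ℝ E - 1)) * f (r • (ζ : E))) ∂μ.toSphere := by
  have h1 : ∫⁻ x, f x ∂μ = ∫⁻ x : ({(0)}ᶜ : Set E), f x.1 ∂(μ.comap (↑)) := by
    rw [lintegral_subtype_comap (measurableSet_singleton _).compl f,
      restrict_compl_singleton]
  have h2 := (μ.measurePreserving_homeomorphUnitSphereProd).lintegral_comp
    (f := fun x : Metric.sphere (0 : E) 1 × Set.Ioi (0 : ℝ) => f ((x.2 : ℝ) • (x.1 : E)))
    (by fun_prop)
  have h3 : ∀ x : ({(0)}ᶜ : Set E), (((homeomorphUnitSphereProd E) x).2 : ℝ) •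
      (((homeomorphUnitSphereProd E) x).1 : E) = x := by
    intro x
    have hx : ‖(x : E)‖ ≠ 0 := norm_ne_zero_iff.2 x.2
    simp [homeomorphUnitSphereProd_apply_snd_coe, homeomorphUnitSphereProd_apply_fst_coe,
      smul_smul, hx]
  simp only [h3] at h2
  rw [h1, h2, lintegral_prod _ (by fun_prop)]
  refine lintegral_congr fun ζ => ?_
  rw [Measure.volumeIoiPow, lintegral_withDensity_eq_lintegral_mul _ (by fun_prop) (by fun_prop)]
  simp only [Pi.mul_apply]
  rw [lintegral_subtype_comap measurableSet_Ioi
    (fun r : ℝ => ENNReal.ofReal (r ^ (Module.finrank ℝ E - 1)) * f (r • (ζ : E)))]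

/-- **Minkowski's integral inequality** for nonnegative functions. -/
theorem lintegral_minkowski {α β : Type*} [MeasurableSpace α] [MeasurableSpace β]
    {μ : Measure α} {ν : Measure β} [IsFiniteMeasure μ] [SFinite ν] {r : ℝ} (hr : 1 ≤ r)
    {F : α → β → ℝ≥0∞} (hF : Measurable (Function.uncurry F)) :
    (∫⁻ x, (∫⁻ y, F x y ∂ν) ^ r ∂μ) ^ (1 / r) ≤
      ∫⁻ y, (∫⁻ x, F x y ^ r ∂μ) ^ (1 / r) ∂ν := by
  rcases hr.eq_or_lt with rfl | hr1
  · simpa using (lintegral_lintegral_swap hF.aemeasurable).le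
  have hr0 : 0 < r := by linarith
  set G : α → ℝ≥0∞ := fun x => ∫⁻ y, F x y ∂ν with hG
  have hGm : Measurable G := hF.lintegral_prod_right'
  set R : ℝ≥0∞ := ∫⁻ y, (∫⁻ x, F x y ^ r ∂μ) ^ (1 / r) ∂ν with hR
  have hconj : r.HolderConjugate (r / (r - 1)) := by
    simpa [Real.conjExponent] using Real.HolderConjugate.conjExponent hr1
  -- Truncating at N makes the left side finite (μ is finite), which is needed to divide by a power
  -- of it below.
  have key : ∀ N : ℕ, (∫⁻ x, (min (G x) N) ^ r ∂μ) ≤ R ^ r := by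
    intro N
    set I : ℝ≥0∞ := ∫⁻ x, (min (G x) N) ^ r ∂μ with hI
    have hI_top : I ≠ ∞ := by
      refine ((lintegral_mono (g := fun _ => (N : ℝ≥0∞) ^ r) fun x => ?_).trans_lt ?_).ne
      · exact ENNReal.rpow_le_rpow (min_le_right _ _) hr0.le
      · rw [lintegral_const]
        exact ENNReal.mul_lt_top (ENNReal.rpow_lt_top_of_nonneg hr0.le (by simp))
          (measure_lt_top _ _)
    by_cases hI0 : I = 0
    · rw [hI0]; exact zero_le
    have hmm : Measurable fun x => (min (G x) N) ^ (r - 1) := by fun_prop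
    -- Duality: one factor of the r-th power is expanded as an integral, and Hölder in x is applied
    -- to F(·,y) against the remaining power r - 1.
    have h1 : I ≤ R * I ^ (1 / (r / (r - 1))) := by
      calc I ≤ ∫⁻ x, G x * (min (G x) N) ^ (r - 1) ∂μ := by
            refine lintegral_mono fun x => ?_
            have : (min (G x) N) ^ r = (min (G x) N) * (min (G x) N) ^ (r - 1) := by
              conv_lhs => rw [show r = 1 + (r - 1) by ring]
              rw [ENNReal.rpow_add_of_nonneg _ _ zero_le_one (by linarith), ENNReal.rpow_one]
            rw [this]
            gcongr
            exact min_le_left _ _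
        _ = ∫⁻ x, ∫⁻ y, F x y * (min (G x) N) ^ (r - 1) ∂ν ∂μ := by
            refine lintegral_congr fun x => ?_
            exact (lintegral_mul_const _ (hF.comp measurable_prodMk_left)).symm
        _ = ∫⁻ y, ∫⁻ x, F x y * (min (G x) N) ^ (r - 1) ∂μ ∂ν := by
            rw [lintegral_lintegral_swap]
            exact (hF.mul (hmm.comp measurable_fst)).aemeasurable
        _ ≤ ∫⁻ y, (∫⁻ x, F x y ^ r ∂μ) ^ (1 / r) * I ^ (1 / (r / (r - 1))) ∂ν := by
            refine lintegral_mono fun y => ?_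
            refine (ENNReal.lintegral_mul_le_Lp_mul_Lq μ hconj
              (f := fun x => F x y) (g := fun x => (min (G x) N) ^ (r - 1))
              (hF.comp measurable_prodMk_right).aemeasurable hmm.aemeasurable).trans_eq ?_
            congr 2
            refine lintegral_congr fun x => ?_
            rw [← ENNReal.rpow_mul]
            congr 1
            have : r - 1 ≠ 0 := by linarith
            field_simp
        _ = R * I ^ (1 / (r / (r - 1))) := by
            rw [lintegral_mul_const]
            exact (Measurable.lintegral_prod_left' (f := fun z : α × β => F z.1 z.2 ^ r)
              (hF.pow_const r)).pow_const _
    have h2 : I ^ (1 / r) ≤ R := by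
      have hsplit : I = I ^ (1 / r) * I ^ (1 / (r / (r - 1))) := by
        rw [← ENNReal.rpow_add _ _ hI0 hI_top]
        have : 1 / r + 1 / (r / (r - 1)) = 1 := by
          have : r - 1 ≠ 0 := by linarith
          field_simp; ring
        rw [this, ENNReal.rpow_one]
      have hne0 : I ^ (1 / (r / (r - 1))) ≠ 0 := by
        simp [hI0, hI_top]
      have hnet : I ^ (1 / (r / (r - 1))) ≠ ∞ := by
        refine ENNReal.rpow_ne_top_of_nonneg ?_ hI_top
        have : 0 < r - 1 := by linarith
        positivity
      rw [hsplit] at h1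
      exact (ENNReal.mul_le_mul_iff_left hne0 hnet).1 (by rwa [← hsplit] at h1 ⊢)
    calc I = (I ^ (1 / r)) ^ r := by
          rw [← ENNReal.rpow_mul, one_div_mul_cancel hr0.ne', ENNReal.rpow_one]
      _ ≤ R ^ r := ENNReal.rpow_le_rpow h2 hr0.le
  -- Monotone convergence removes the truncation.
  have hlim : ∫⁻ x, G x ^ r ∂μ ≤ R ^ r := by
    have hsup : ∀ x, G x ^ r = ⨆ N : ℕ, (min (G x) N) ^ r := by
      intro x
      refine le_antisymm ?_ (iSup_le fun N => ENNReal.rpow_le_rpow (min_le_left _ _) hr0.le)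
      have ht : Filter.Tendsto (fun N : ℕ => (min (G x) N) ^ r) Filter.atTop
          (nhds ((min (G x) ∞) ^ r)) :=
        ((ENNReal.continuous_rpow_const.tendsto _).comp
          (tendsto_const_nhds.min ENNReal.tendsto_nat_nhds_top))
      rw [min_eq_left le_top] at ht
      exact le_of_tendsto' ht fun N => le_iSup (fun N : ℕ => (min (G x) N) ^ r) N
    simp_rw [hsup]
    rw [lintegral_iSup (fun N => by fun_prop)]
    · exact iSup_le key
    · intro N M hNM x
      exact ENNReal.rpow_le_rpow (min_le_min_left _ (by exact_mod_cast hNM)) hr0.le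
  calc (∫⁻ x, G x ^ r ∂μ) ^ (1 / r) ≤ (R ^ r) ^ (1 / r) :=
        ENNReal.rpow_le_rpow hlim (by positivity)
    _ = R := by rw [← ENNReal.rpow_mul, mul_one_div_cancel hr0.ne', ENNReal.rpow_one]

namespace ForelliRudin

variable {n : ℕ}

/-! ### Boxes and the volume of nonisotropic balls -/

/-- The polydisc-like box whose coordinate `i₀` is centred at `c` with radius `r₀` and whose other
coordinates are centred at the origin with radius `r₁`. -/
def box (i₀ : Fin n) (c : ℂ) (r₀ r₁ : ℝ) : Set (Cn n) :=
  {y | ‖y i₀ - c‖ < r₀ ∧ ∀ j, j ≠ i₀ → ‖y j‖ < r₁}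

/-- In coordinates the Euclidean volume is a Haar measure, hence a positive multiple of the product
measure. Only the scaling in r₀ and r₁ matters later, so the constant is left as κ. -/
theorem volume_box (i₀ : Fin n) :
    ∃ κ : ℝ≥0∞, κ ≠ 0 ∧ κ ≠ ∞ ∧ ∀ (c : ℂ) (r₀ r₁ : ℝ), 0 < r₀ → 0 < r₁ →
      volume (box i₀ c r₀ r₁) = κ * ENNReal.ofReal (r₀ ^ 2 * (r₁ ^ 2) ^ (n - 1)) := by
  let e := PiLp.continuousLinearEquiv 2 ℝ (fun _ : Fin n => ℂ)
  have hmap : (Measure.map e (volume : Measure (Cn n))).IsAddHaarMeasure :=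
    e.isAddHaarMeasure_map volume
  set m := Measure.map e (volume : Measure (Cn n)) with hm
  have hme : m = Measure.addHaarScalarFactor m volume • volume :=
    Measure.isAddLeftInvariant_eq_smul m volume
  have hpos := Measure.addHaarScalarFactor_pos_of_isAddHaarMeasure m
    (volume : Measure (Fin n → ℂ))
  set k := Measure.addHaarScalarFactor m (volume : Measure (Fin n → ℂ)) with hk
  refine ⟨k * ((NNReal.pi : ℝ≥0∞)) ^ n, ?_, ?_, ?_⟩
  · have : (NNReal.pi : ℝ≥0∞) ≠ 0 := by
      simpa using NNReal.pi_ne_zero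
    exact mul_ne_zero (by exact_mod_cast hpos.ne') (pow_ne_zero _ this)
  · exact ENNReal.mul_ne_top (by simp) (ENNReal.pow_ne_top (by simp))
  · intro c r₀ r₁ h0 h1
    have hset : box i₀ c r₀ r₁ = e ⁻¹' (Set.univ.pi fun j =>
        Metric.ball (if j = i₀ then c else 0) (if j = i₀ then r₀ else r₁)) := by
      ext y
      simp only [box, Set.mem_ofPred_eq, Set.mem_preimage, Set.mem_univ_pi, Metric.mem_ball,
        dist_eq_norm]
      constructor
      · rintro ⟨h, h'⟩ j
        by_cases hj : j = i₀
        · subst hj; simpa [e] using h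
        · simpa [e, hj] using h' j hj
      · intro h
        refine ⟨by simpa [e] using h i₀, fun j hj => by simpa [e, hj] using h j⟩
    have hvol : volume (box i₀ c r₀ r₁) = m (Set.univ.pi fun j =>
        Metric.ball (if j = i₀ then c else 0) (if j = i₀ then r₀ else r₁)) := by
      rw [hset, hm, Measure.map_apply e.continuous.measurable]
      exact MeasurableSet.univ_pi fun j => measurableSet_ball
    rw [hvol, hme, Measure.smul_apply, volume_pi_pi]
    simp only [Complex.volume_ball]
    rw [Finset.prod_mul_distrib]
    simp only [Finset.prod_const, Finset.card_univ, Fintype.card_fin]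
    have hp : (∏ j : Fin n, ENNReal.ofReal (if j = i₀ then r₀ else r₁) ^ 2) =
        ENNReal.ofReal (r₀ ^ 2 * (r₁ ^ 2) ^ (n - 1)) := by
      rw [← Finset.mul_prod_erase _ _ (Finset.mem_univ i₀)]
      rw [Finset.prod_congr rfl (g := fun _ => ENNReal.ofReal r₁ ^ 2)]
      · rw [if_pos rfl, Finset.prod_const, Finset.card_erase_of_mem (Finset.mem_univ _),
          Finset.card_univ, Fintype.card_fin, ENNReal.ofReal_mul (by positivity),
          ENNReal.ofReal_pow h0.le, ENNReal.ofReal_pow (sq_nonneg r₁),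
          ENNReal.ofReal_pow h1.le]
      · intro j hj
        rw [if_neg (Finset.ne_of_mem_erase hj)]
    rw [hp, ENNReal.smul_def, smul_eq_mul]
    ring

theorem measurableSet_box (i₀ : Fin n) (c : ℂ) (r₀ r₁ : ℝ) : MeasurableSet (box i₀ c r₀ r₁) := by
  have : box i₀ c r₀ r₁ = {y : Cn n | ‖y i₀ - c‖ < r₀} ∩
      ⋂ j : Fin n, ⋂ _ : j ≠ i₀, {y : Cn n | ‖y j‖ < r₁} := by
    ext y; simp [box]
  rw [this]
  refine MeasurableSet.inter ?_ (MeasurableSet.iInter fun j => MeasurableSet.iInter fun _ => ?_)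
  · exact (isOpen_lt (by fun_prop) (by fun_prop)).measurableSet
  · exact (isOpen_lt (by fun_prop) (by fun_prop)).measurableSet

theorem one_sub_le_norm_one_sub {ω : ℂ} : 1 - ‖ω‖ ≤ ‖1 - ω‖ := by
  have := norm_sub_norm_le (1 : ℂ) ω
  simpa using this

theorem norm_inner_le_of_mem_ball {z u : Cn n} (hu : ‖u‖ ≤ 1) :
    ‖inner ℂ u z‖ ≤ ‖z‖ := by
  calc ‖inner ℂ u z‖ ≤ ‖u‖ * ‖z‖ := norm_inner_le_norm _ _
    _ ≤ 1 * ‖z‖ := by gcongr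
    _ = ‖z‖ := one_mul _

/-- Allows z to be placed on a coordinate axis, so that ⟨z,u⟩ depends on a single coordinate of u.
-/
theorem exists_orthonormalBasis_smul (i₀ : Fin n) (z : Cn n) :
    ∃ b : OrthonormalBasis (Fin n) ℂ (Cn n), z = ((‖z‖ : ℝ) : ℂ) • b i₀ := by
  have hcard : Module.finrank ℂ (Cn n) = Fintype.card (Fin n) := by simp
  by_cases hz : z = 0
  · exact ⟨EuclideanSpace.basisFun (Fin n) ℂ, by simp [hz]⟩
  have hz' : ‖z‖ ≠ 0 := norm_ne_zero_iff.2 hz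
  obtain ⟨b, hb⟩ := Orthonormal.exists_orthonormalBasis_extension_of_card_eq (𝕜 := ℂ) hcard
    (v := fun _ => ((‖z‖⁻¹ : ℝ) : ℂ) • z) (s := {i₀}) (by
      constructor
      · rintro ⟨i, hi⟩
        simp [norm_smul, hz']
      · rintro ⟨i, hi⟩ ⟨j, hj⟩ hij
        exact absurd (Subtype.ext ((Set.mem_singleton_iff.1 hi).trans
          (Set.mem_singleton_iff.1 hj).symm)) hij)
  refine ⟨b, ?_⟩
  rw [hb i₀ rfl, smul_smul]
  norm_cast
  simp [hz']

theorem measurePreserving_orthonormalBasis_repr (b : OrthonormalBasis (Fin n) ℂ (Cn n)) :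
    MeasurePreserving (b.repr : Cn n → Cn n) volume volume := by
  let f : Cn n ≃ₗᵢ[ℝ] Cn n :=
    { toLinearEquiv := b.repr.toLinearEquiv.restrictScalars ℝ
      norm_map' := fun x => b.repr.norm_map x }
  exact f.measurePreserving

/-- The nonisotropic balls `{u : |1 - ⟨z, u⟩| < R}` have volume `O(R^{n+1})`. -/
theorem exists_volume_nonisotropic_ball_le (hn : 1 ≤ n) :
    ∃ C : ℝ≥0∞, C ≠ ∞ ∧ ∀ z ∈ Metric.ball (0 : Cn n) 1, ∀ R : ℝ, 0 < R →
      volume {u : Cn n | u ∈ Metric.ball 0 1 ∧ ‖1 - inner ℂ u z‖ < R} ≤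
        C * ENNReal.ofReal (R ^ (n + 1)) := by
  let i₀ : Fin n := ⟨0, hn⟩
  obtain ⟨κ, -, hκ, hbox⟩ := volume_box i₀
  refine ⟨κ * ENNReal.ofReal (4 * 4 ^ (n - 1)), ENNReal.mul_ne_top hκ ENNReal.ofReal_ne_top,
    fun z hz R hR => ?_⟩
  obtain ⟨b, hb⟩ := exists_orthonormalBasis_smul i₀ z
  have hz1 : ‖z‖ < 1 := by simpa using hz
  -- With z = |z|e and y the coordinates of u, ⟨z,u⟩ is |z| times the conjugate of y at `i₀`. Being
  -- within R of 1 forces both 1 - |z| < R and |y at `i₀` - 1| < 2R. The other coordinates have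
  -- squared modulus at most 1 - |y at `i₀`|² ≤ 2(1 - |y at `i₀`|) < 4R.
  have hsub : {u : Cn n | u ∈ Metric.ball 0 1 ∧ ‖1 - inner ℂ u z‖ < R} ⊆
      b.repr ⁻¹' box i₀ 1 (2 * R) (2 * Real.sqrt R) := by
    rintro u ⟨hu, huR⟩
    have hu1 : ‖u‖ < 1 := by simpa using hu
    set y := b.repr u with hy
    have hyn : ‖y‖ = ‖u‖ := b.repr.norm_map u
    have hy0 : y i₀ = inner ℂ (b i₀) u := b.repr_apply_apply u i₀
    have hyi : ‖y i₀‖ ≤ 1 := by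
      have := PiLp.norm_apply_le y i₀
      linarith
    have hX : ‖1 - (‖z‖ : ℂ) * y i₀‖ < R := by
      have h1 : inner ℂ u z = (‖z‖ : ℂ) * (starRingEnd ℂ) (y i₀) := by
        conv_lhs => rw [hb]
        rw [inner_smul_right, hy0, inner_conj_symm]
      rw [h1, ← Complex.norm_conj] at huR
      simpa using huR
    have hr : 1 - ‖z‖ < R := by
      have h1 := one_sub_le_norm_one_sub (ω := (‖z‖ : ℂ) * y i₀)
      have h2 : ‖(‖z‖ : ℂ) * y i₀‖ ≤ ‖z‖ := by
        rw [norm_mul]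
        simpa using mul_le_of_le_one_right (norm_nonneg z) hyi
      linarith
    have hfirst : ‖y i₀ - 1‖ < 2 * R := by
      have h1 : y i₀ - 1 = -(1 - (‖z‖ : ℂ) * y i₀) + ((1 - ‖z‖ : ℝ) : ℂ) * y i₀ := by
        push_cast; ring
      rw [h1]
      have h2 : ‖((1 - ‖z‖ : ℝ) : ℂ) * y i₀‖ ≤ 1 - ‖z‖ := by
        rw [norm_mul, Complex.norm_real, Real.norm_of_nonneg (by linarith)]
        exact mul_le_of_le_one_right (by linarith) hyi
      calc _ ≤ ‖-(1 - (‖z‖ : ℂ) * y i₀)‖ + ‖((1 - ‖z‖ : ℝ) : ℂ) * y i₀‖ := norm_add_le _ _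
        _ < 2 * R := by rw [norm_neg]; linarith
    refine ⟨hfirst, fun j hj => ?_⟩
    have hsum : ‖y i₀‖ ^ 2 + ‖y j‖ ^ 2 ≤ 1 := by
      have h1 : ‖y i₀‖ ^ 2 + ‖y j‖ ^ 2 ≤ ‖y‖ ^ 2 := by
        rw [EuclideanSpace.norm_sq_eq, ← Finset.sum_pair (f := fun i => ‖y i‖ ^ 2) hj.symm]
        exact Finset.sum_le_sum_of_subset_of_nonneg (Finset.subset_univ _)
          fun _ _ _ => sq_nonneg _
      have h2 : ‖y‖ ^ 2 ≤ 1 := by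
        rw [hyn]; nlinarith [norm_nonneg u]
      linarith
    have h3 : 1 - ‖y i₀‖ < 2 * R := by
      have := one_sub_le_norm_one_sub (ω := y i₀)
      rw [norm_sub_rev] at this
      linarith
    have h4 : ‖y j‖ ^ 2 < (2 * Real.sqrt R) ^ 2 := by
      rw [mul_pow, Real.sq_sqrt hR.le]
      nlinarith [norm_nonneg (y i₀)]
    exact lt_of_pow_lt_pow_left₀ 2 (by positivity) h4
  calc _ ≤ volume (b.repr ⁻¹' box i₀ 1 (2 * R) (2 * Real.sqrt R)) := measure_mono hsub
    _ = volume (box i₀ (1 : ℂ) (2 * R) (2 * Real.sqrt R)) :=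
      (measurePreserving_orthonormalBasis_repr b).measure_preimage
        (measurableSet_box _ _ _ _).nullMeasurableSet
    _ = κ * ENNReal.ofReal (4 * 4 ^ (n - 1)) * ENNReal.ofReal (R ^ (n + 1)) := by
      rw [hbox _ _ _ (by positivity) (by positivity), mul_assoc,
        ← ENNReal.ofReal_mul (by positivity)]
      congr 2
      rw [mul_pow, mul_pow, Real.sq_sqrt hR.le, mul_pow]
      have : R ^ (n + 1) = R ^ 2 * R ^ (n - 1) := by
        rw [← pow_add]; congr 1; omega
      rw [this]; ring

/-! ### Weighted volume of nonisotropic balls -/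

theorem lintegral_one_sub_rpow {s R : ℝ} (hs : -1 < s) (hR : 0 < R) :
    ∫⁻ ρ in Set.Ioo (1 - R) 1, ENNReal.ofReal ((1 - ρ) ^ s) =
      ENNReal.ofReal (R ^ (s + 1) / (s + 1)) := by
  have hint : IntervalIntegrable (fun ρ : ℝ => (1 - ρ) ^ s) volume (1 - R) 1 := by
    have := (intervalIntegral.intervalIntegrable_rpow' (a := R) (b := 0) hs).comp_sub_left 1
    simpa using this
  rw [restrict_Ioo_eq_restrict_Ioc, ← ofReal_integral_eq_lintegral_ofReal,
    ← intervalIntegral.integral_of_le (by linarith),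
    intervalIntegral.integral_comp_sub_left (fun x => x ^ s) 1]
  · rw [integral_rpow (Or.inl hs)]
    simp [Real.zero_rpow (show s + 1 ≠ 0 by linarith)]
  · exact (intervalIntegrable_iff_integrableOn_Ioc_of_le (by linarith)).1 hint
  · filter_upwards [ae_restrict_mem measurableSet_Ioc] with ρ hρ
    exact Real.rpow_nonneg (by linarith [hρ.2]) _

theorem one_sub_sq_rpow_le {s ρ : ℝ} (h0 : 0 ≤ ρ) (h1 : ρ < 1) :
    (1 - ρ ^ 2) ^ s ≤ 2 ^ |s| * (1 - ρ) ^ s := by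
  have h : 1 - ρ ^ 2 = (1 + ρ) * (1 - ρ) := by ring
  rw [h, Real.mul_rpow (by linarith) (by linarith)]
  refine mul_le_mul_of_nonneg_right ?_ (Real.rpow_nonneg (by linarith) _)
  calc (1 + ρ) ^ s ≤ (1 + ρ) ^ |s| :=
        Real.rpow_le_rpow_of_exponent_le (by linarith) (le_abs_self s)
    _ ≤ 2 ^ |s| := Real.rpow_le_rpow (by linarith) (by linarith) (abs_nonneg s)

/-- On each ray, the weight `(1 - ρ²)^s` restricted to `|1 - ρω| < R` is comparable to `R^s`
on average. -/
theorem exists_radial_comparison {s : ℝ} (hs : -1 < s) (N : ℕ) :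
    ∃ C : ℝ≥0∞, C ≠ ∞ ∧ ∀ ω : ℂ, ‖ω‖ ≤ 1 → ∀ R : ℝ, 0 < R → R ≤ 2 →
      ∫⁻ ρ in Set.Ioi (0 : ℝ), ENNReal.ofReal (ρ ^ N) *
        {ρ : ℝ | ρ < 1 ∧ ‖1 - ρ * ω‖ < R}.indicator (fun ρ => ENNReal.ofReal ((1 - ρ ^ 2) ^ s)) ρ ≤
      C * ENNReal.ofReal (R ^ s) * ∫⁻ ρ in Set.Ioi (0 : ℝ), ENNReal.ofReal (ρ ^ N) *
        {ρ : ℝ | ρ < 1 ∧ ‖1 - ρ * ω‖ < 2 * R}.indicator 1 ρ := by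
  -- The constant is the quotient of the upper bound `hup` by R^s times the lower bound `hlow`.
  refine ⟨ENNReal.ofReal (2 ^ |s| * 4 * 2 ^ N / (s + 1)), ENNReal.ofReal_ne_top,
    fun ω hω R hR hR2 => ?_⟩
  have hs1 : 0 < s + 1 := by linarith
  have hball : ∀ ρ : ℝ, 0 < ρ → ‖1 - ρ * ω‖ < R → 1 - R < ρ := by
    intro ρ hρ h
    have h1 := one_sub_le_norm_one_sub (ω := ρ * ω)
    have h2 : ‖(ρ : ℂ) * ω‖ ≤ ρ := by
      rw [norm_mul, Complex.norm_real, Real.norm_of_nonneg hρ.le]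
      exact mul_le_of_le_one_right hρ.le hω
    linarith
  by_cases hemp : ∃ ρ₀ : ℝ, 0 < ρ₀ ∧ ρ₀ < 1 ∧ ‖1 - ρ₀ * ω‖ < R
  · obtain ⟨ρ₀, h00, h01, h0R⟩ := hemp
    -- If the ray meets the ball at ρ₀ > 1 - R, every ρ in (1 - R/4, 1) is within R of ρ₀ and so
    -- lies in the doubled ball. R ≤ 2 makes these ρ at least 1/2, which bounds the Jacobian ρ^N
    -- below.
    have hlow : ENNReal.ofReal ((1 / 2) ^ N * (R / 4)) ≤
        ∫⁻ ρ in Set.Ioi (0 : ℝ), ENNReal.ofReal (ρ ^ N) *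
          {ρ : ℝ | ρ < 1 ∧ ‖1 - ρ * ω‖ < 2 * R}.indicator 1 ρ := by
      calc ENNReal.ofReal ((1 / 2) ^ N * (R / 4))
          = ∫⁻ ρ in Set.Ioo (1 - R / 4) 1, ENNReal.ofReal ((1 / 2) ^ N) := by
            rw [setLIntegral_const, Real.volume_Ioo, ← ENNReal.ofReal_mul (by positivity)]
            congr 1; ring
        _ ≤ ∫⁻ ρ in Set.Ioo (1 - R / 4) 1, ENNReal.ofReal (ρ ^ N) *
              {ρ : ℝ | ρ < 1 ∧ ‖1 - ρ * ω‖ < 2 * R}.indicator 1 ρ := by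
            refine setLIntegral_mono' measurableSet_Ioo fun ρ hρ => ?_
            have hmem : ρ ∈ {ρ : ℝ | ρ < 1 ∧ ‖1 - ρ * ω‖ < 2 * R} := by
              refine ⟨hρ.2, ?_⟩
              have h1 : 1 - (ρ : ℂ) * ω = (1 - ρ₀ * ω) + ((ρ₀ - ρ : ℝ) : ℂ) * ω := by
                push_cast; ring
              have h2 : ‖((ρ₀ - ρ : ℝ) : ℂ) * ω‖ ≤ R := by
                rw [norm_mul, Complex.norm_real]
                refine (mul_le_of_le_one_right (norm_nonneg _) hω).trans ?_
                rw [Real.norm_eq_abs, abs_le]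
                have := hball ρ₀ h00 h0R
                constructor <;> linarith [hρ.1, hρ.2]
              rw [h1]
              linarith [norm_add_le (1 - (ρ₀ : ℂ) * ω) (((ρ₀ - ρ : ℝ) : ℂ) * ω)]
            rw [Set.indicator_of_mem hmem, Pi.one_apply, mul_one]
            gcongr
            linarith [hρ.1]
        _ ≤ _ := lintegral_mono_set fun ρ hρ => by
            have := hρ.1
            simp only [Set.mem_Ioi]; linarith
    have hup : ∫⁻ ρ in Set.Ioi (0 : ℝ), ENNReal.ofReal (ρ ^ N) *
        {ρ : ℝ | ρ < 1 ∧ ‖1 - ρ * ω‖ < R}.indicator (fun ρ => ENNReal.ofReal ((1 - ρ ^ 2) ^ s)) ρ ≤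
        ENNReal.ofReal (2 ^ |s| * (R ^ (s + 1) / (s + 1))) := by
      rw [ENNReal.ofReal_mul (by positivity), ← lintegral_one_sub_rpow hs hR,
        ← lintegral_const_mul _ (by fun_prop), ← lintegral_indicator measurableSet_Ioo,
        ← lintegral_indicator measurableSet_Ioi]
      refine lintegral_mono fun ρ => ?_
      by_cases hρ0 : ρ ∈ Set.Ioi (0 : ℝ)
      swap
      · rw [Set.indicator_of_notMem hρ0]; exact zero_le
      rw [Set.indicator_of_mem hρ0]
      by_cases hρ : ρ ∈ {ρ : ℝ | ρ < 1 ∧ ‖1 - ρ * ω‖ < R}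
      swap
      · rw [Set.indicator_of_notMem hρ, mul_zero]; exact zero_le
      have hρ0' : 0 < ρ := hρ0
      rw [Set.indicator_of_mem hρ,
        Set.indicator_of_mem (show ρ ∈ Set.Ioo (1 - R) 1 from ⟨hball ρ hρ0 hρ.2, hρ.1⟩),
        ← ENNReal.ofReal_mul (by positivity), ← ENNReal.ofReal_mul (by positivity)]
      refine ENNReal.ofReal_le_ofReal ?_
      have h1 := one_sub_sq_rpow_le (s := s) hρ0'.le hρ.1
      have h2 : ρ ^ N ≤ 1 := pow_le_one₀ hρ0'.le hρ.1.le
      have h3 : (0 : ℝ) ≤ (1 - ρ ^ 2) ^ s := Real.rpow_nonneg (by nlinarith [hρ.1]) _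
      nlinarith
    refine hup.trans ?_
    refine le_trans ?_ (mul_le_mul_right hlow _)
    rw [← ENNReal.ofReal_mul (by positivity), ← ENNReal.ofReal_mul (by positivity)]
    refine ENNReal.ofReal_le_ofReal (le_of_eq ?_)
    rw [Real.rpow_add hR, Real.rpow_one, one_div, inv_pow]
    field_simp
  · push Not at hemp
    have h0 : ∀ ρ ∈ Set.Ioi (0 : ℝ), ENNReal.ofReal (ρ ^ N) *
        {ρ : ℝ | ρ < 1 ∧ ‖1 - ρ * ω‖ < R}.indicator
          (fun ρ => ENNReal.ofReal ((1 - ρ ^ 2) ^ s)) ρ = 0 := by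
      intro ρ hρ
      rw [Set.indicator_of_notMem, mul_zero]
      rintro ⟨h1, h2⟩
      exact absurd h2 (not_lt.2 (hemp ρ hρ h1))
    rw [setLIntegral_congr_fun measurableSet_Ioi h0]
    simp

/-- The weight `(1 - |z|²)^s` with values in `[0, ∞]`. -/
noncomputable def wt (s : ℝ) (z : Cn n) : ℝ≥0∞ := ENNReal.ofReal ((1 - ‖z‖ ^ 2) ^ s)

/-- The power `|1 - ⟨z, u⟩|^s` with values in `[0, ∞]`. -/
noncomputable def kerPow (s : ℝ) (z u : Cn n) : ℝ≥0∞ := ENNReal.ofReal (‖1 - inner ℂ u z‖ ^ s)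

@[fun_prop]
theorem measurable_wt (s : ℝ) : Measurable (wt s : Cn n → ℝ≥0∞) := by
  unfold wt; fun_prop

theorem measurable_kerPow (s : ℝ) : Measurable fun x : Cn n × Cn n => kerPow s x.1 x.2 := by
  unfold kerPow
  have : Continuous fun x : Cn n × Cn n => ‖1 - inner ℂ x.2 x.1‖ := by fun_prop
  fun_prop

theorem one_sub_sq_pos {z : Cn n} (hz : z ∈ Metric.ball (0 : Cn n) 1) : 0 < 1 - ‖z‖ ^ 2 := by
  have : ‖z‖ < 1 := by simpa using hz
  nlinarith [norm_nonneg z]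

/-- In polar coordinates the comparison holds on every ray separately, with ω = ⟨z,ζ⟩ for the
direction ζ. The weight thereby becomes a factor R^s, at the cost of doubling the radius. -/
theorem setLIntegral_nonisotropic_ball_le_volume (hn : 1 ≤ n) {s : ℝ} (hs : -1 < s) :
    ∃ C : ℝ≥0∞, C ≠ ∞ ∧ ∀ z ∈ Metric.ball (0 : Cn n) 1, ∀ R : ℝ, 0 < R → R ≤ 2 →
      ∫⁻ u in {u : Cn n | u ∈ Metric.ball 0 1 ∧ ‖1 - inner ℂ u z‖ < R}, wt s u ≤
        C * ENNReal.ofReal (R ^ s) *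
          volume {u : Cn n | u ∈ Metric.ball 0 1 ∧ ‖1 - inner ℂ u z‖ < 2 * R} := by
  have : Nonempty (Fin n) := ⟨⟨0, hn⟩⟩
  obtain ⟨C, hC, h⟩ := exists_radial_comparison hs (Module.finrank ℝ (Cn n) - 1)
  refine ⟨C, hC, fun z hz R hR hR2 => ?_⟩
  have hz1 : ‖z‖ < 1 := by simpa using hz
  have hmeas : ∀ R : ℝ, MeasurableSet {u : Cn n | u ∈ Metric.ball 0 1 ∧ ‖1 - inner ℂ u z‖ < R} :=
    fun R => (Metric.isOpen_ball.inter (isOpen_lt (f := fun u : Cn n => ‖1 - inner ℂ u z‖)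
      (by fun_prop) continuous_const)).measurableSet
  have hmem : ∀ (R : ℝ) (ζ : Metric.sphere (0 : Cn n) 1) (ρ : ℝ), 0 < ρ →
      (ρ • (ζ : Cn n) ∈ {u : Cn n | u ∈ Metric.ball 0 1 ∧ ‖1 - inner ℂ u z‖ < R} ↔
        ρ ∈ {ρ : ℝ | ρ < 1 ∧ ‖1 - ρ * inner ℂ (ζ : Cn n) z‖ < R}) := by
    intro R ζ ρ hρ
    have hζ : ‖(ζ : Cn n)‖ = 1 := by simp
    have h1 : inner ℂ (ρ • (ζ : Cn n)) z = (ρ : ℂ) * inner ℂ (ζ : Cn n) z := by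
      rw [← Complex.coe_smul, inner_smul_left, Complex.conj_ofReal]
    simp only [Set.mem_ofPred_eq, h1, mem_ball_zero_iff, norm_smul, hζ, mul_one,
      Real.norm_of_nonneg hρ.le]
  rw [← lintegral_indicator (hmeas R), ← lintegral_indicator_one (hmeas (2 * R)),
    lintegral_polarCoord_addHaar volume ((measurable_wt s).indicator (hmeas R)),
    lintegral_polarCoord_addHaar volume (measurable_one.indicator (hmeas (2 * R))),
    ← lintegral_const_mul' _ _ (ENNReal.mul_ne_top hC ENNReal.ofReal_ne_top)]
  refine lintegral_mono fun ζ => ?_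
  have hζ : ‖(ζ : Cn n)‖ = 1 := by simp
  refine le_trans (le_of_eq ?_) ((h (inner ℂ (ζ : Cn n) z)
    ((norm_inner_le_of_mem_ball hζ.le).trans hz1.le) R hR hR2).trans (le_of_eq ?_))
  · refine setLIntegral_congr_fun measurableSet_Ioi fun ρ hρ => ?_
    have hρ' : ‖ρ • (ζ : Cn n)‖ = ρ := by
      rw [norm_smul, hζ, mul_one, Real.norm_of_nonneg (le_of_lt hρ)]
    by_cases hm : ρ ∈ {ρ : ℝ | ρ < 1 ∧ ‖1 - ρ * inner ℂ (ζ : Cn n) z‖ < R}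
    · simp only [Set.indicator_of_mem hm, Set.indicator_of_mem ((hmem R ζ ρ hρ).2 hm), wt, hρ']
    · simp only [Set.indicator_of_notMem hm, Set.indicator_of_notMem (mt (hmem R ζ ρ hρ).1 hm)]
  · congr 1
    refine setLIntegral_congr_fun measurableSet_Ioi fun ρ hρ => ?_
    by_cases hm : ρ ∈ {ρ : ℝ | ρ < 1 ∧ ‖1 - ρ * inner ℂ (ζ : Cn n) z‖ < 2 * R}
    · simp only [Set.indicator_of_mem hm, Set.indicator_of_mem ((hmem (2 * R) ζ ρ hρ).2 hm),
        Pi.one_apply]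
    · simp only [Set.indicator_of_notMem hm,
        Set.indicator_of_notMem (mt (hmem (2 * R) ζ ρ hρ).1 hm)]

theorem norm_one_sub_inner_lt_two {z u : Cn n} (hz : z ∈ Metric.ball (0 : Cn n) 1)
    (hu : u ∈ Metric.ball (0 : Cn n) 1) : ‖1 - inner ℂ u z‖ < 2 := by
  have hz1 : ‖z‖ < 1 := by simpa using hz
  have hu1 : ‖u‖ < 1 := by simpa using hu
  have h1 := norm_sub_le (1 : ℂ) (inner ℂ u z)
  have h2 := norm_inner_le_of_mem_ball (z := z) hu1.le
  rw [norm_one] at h1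
  linarith

/-- The weighted volume of a nonisotropic ball of radius `R` is `O(R^{n+1+s})`. -/
theorem exists_setLIntegral_nonisotropic_ball_le (hn : 1 ≤ n) {s : ℝ} (hs : -1 < s) :
    ∃ C : ℝ≥0∞, C ≠ ∞ ∧ ∀ z ∈ Metric.ball (0 : Cn n) 1, ∀ R : ℝ, 0 < R →
      ∫⁻ u in {u : Cn n | u ∈ Metric.ball 0 1 ∧ ‖1 - inner ℂ u z‖ < R}, wt s u ≤
        C * ENNReal.ofReal (R ^ (n + 1 + s)) := by
  obtain ⟨C₁, hC₁, h₁⟩ := setLIntegral_nonisotropic_ball_le_volume hn hs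
  obtain ⟨C₂, hC₂, h₂⟩ := exists_volume_nonisotropic_ball_le hn
  have hsmall : ∀ z ∈ Metric.ball (0 : Cn n) 1, ∀ R : ℝ, 0 < R → R ≤ 2 →
      ∫⁻ u in {u : Cn n | u ∈ Metric.ball 0 1 ∧ ‖1 - inner ℂ u z‖ < R}, wt s u ≤
        C₁ * (C₂ * ENNReal.ofReal (2 ^ (n + 1))) * ENNReal.ofReal (R ^ (n + 1 + s)) := by
    intro z hz R hR hR2
    refine (h₁ z hz R hR hR2).trans ((mul_le_mul_right (h₂ z hz (2 * R) (by positivity)) _).trans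
      (le_of_eq ?_))
    have : R ^ (n + 1 + s) = R ^ s * R ^ (n + 1) := by
      rw [add_comm, Real.rpow_add hR]; norm_cast
    rw [mul_pow, ENNReal.ofReal_mul (by positivity), this, ENNReal.ofReal_mul (by positivity)]
    ring
  refine ⟨C₁ * (C₂ * ENNReal.ofReal (2 ^ (n + 1))), ENNReal.mul_ne_top hC₁
    (ENNReal.mul_ne_top hC₂ ENNReal.ofReal_ne_top), fun z hz R hR => ?_⟩
  -- For R > 2 the nonisotropic ball is already the whole unit ball, as it is for R = 2.
  rcases le_or_gt R 2 with hR2 | hR2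
  · exact hsmall z hz R hR hR2
  · calc _ ≤ ∫⁻ u in {u : Cn n | u ∈ Metric.ball 0 1 ∧ ‖1 - inner ℂ u z‖ < 2}, wt s u :=
          lintegral_mono_set fun u hu => ⟨hu.1, norm_one_sub_inner_lt_two hz hu.1⟩
      _ ≤ _ := hsmall z hz 2 two_pos le_rfl
      _ ≤ _ := by gcongr; linarith

/-! ### The Forelli–Rudin estimate -/

/-- **Forelli–Rudin estimate** (upper bound). -/
theorem exists_forelliRudin_le (hn : 1 ≤ n) {s t : ℝ} (hs : -1 < s) (ht : 0 < t) :
    ∃ C : ℝ≥0∞, C ≠ ∞ ∧ ∀ z ∈ Metric.ball (0 : Cn n) 1,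
      ∫⁻ u in Metric.ball (0 : Cn n) 1, wt s u * kerPow (-(n + 1 + s + t)) z u ≤
        C * wt (-t) z := by
  obtain ⟨C, hC, h⟩ := exists_setLIntegral_nonisotropic_ball_le hn hs
  set K : ℝ≥0∞ := ∑' k : ℕ, ENNReal.ofReal ((2 ^ (-t)) ^ k) with hK
  have h2t : (2 : ℝ) ^ (-t) < 1 := Real.rpow_lt_one_of_one_lt_of_neg one_lt_two (by linarith)
  have hKtop : K ≠ ∞ := by
    rw [hK, ← ENNReal.ofReal_tsum_of_nonneg (fun k => by positivity)
      (summable_geometric_of_lt_one (by positivity) h2t)]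
    exact ENNReal.ofReal_ne_top
  refine ⟨C * ENNReal.ofReal (2 ^ (n + 1 + s) * 2 ^ t) * K,
    ENNReal.mul_ne_top (ENNReal.mul_ne_top hC ENNReal.ofReal_ne_top) hKtop, fun z hz => ?_⟩
  have hz1 : ‖z‖ < 1 := by simpa using hz
  set δ : ℝ := 1 - ‖z‖ with hδ
  have hδ0 : 0 < δ := by linarith
  set m : ℝ := n + 1 + s + t with hm
  have hm0 : 0 < m := by
    have : (0 : ℝ) ≤ n := Nat.cast_nonneg n
    linarith
  -- Since |1 - ⟨z,u⟩| ≥ δ, each u has a k with 2^k δ ≤ |1 - ⟨z,u⟩| < 2^(k+1) δ. The k-th term is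
  -- then O((2^k δ)^(-t)), and t > 0 makes the series geometric.
  set A : ℕ → Set (Cn n) :=
    fun k => {u : Cn n | u ∈ Metric.ball 0 1 ∧ ‖1 - inner ℂ u z‖ < 2 ^ (k + 1) * δ} with hA
  have hmeas : ∀ k, MeasurableSet (A k) :=
    fun k => (Metric.isOpen_ball.inter (isOpen_lt (f := fun u : Cn n => ‖1 - inner ℂ u z‖)
      (by fun_prop) continuous_const)).measurableSet
  calc ∫⁻ u in Metric.ball (0 : Cn n) 1, wt s u * kerPow (-m) z u
      ≤ ∫⁻ u in Metric.ball (0 : Cn n) 1, ∑' k : ℕ,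
          ENNReal.ofReal ((2 ^ k * δ) ^ (-m)) * (A k).indicator (wt s) u := by
        refine setLIntegral_mono' measurableSet_ball fun u hu => ?_
        have hu1 : ‖u‖ < 1 := by simpa using hu
        have hX : δ ≤ ‖1 - inner ℂ u z‖ := by
          have h1 := one_sub_le_norm_one_sub (ω := inner ℂ u z)
          have h2 := norm_inner_le_of_mem_ball (z := z) hu1.le
          linarith
        obtain ⟨k, hk1, hk2⟩ := exists_nat_pow_near (x := ‖1 - inner ℂ u z‖ / δ) (y := 2)
          ((one_le_div hδ0).2 hX) one_lt_two
        rw [le_div_iff₀ hδ0] at hk1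
        rw [div_lt_iff₀ hδ0] at hk2
        refine le_trans ?_ (ENNReal.le_tsum k)
        rw [Set.indicator_of_mem (show u ∈ A k from ⟨hu, hk2⟩), mul_comm]
        gcongr
        exact ENNReal.ofReal_le_ofReal
          (Real.rpow_le_rpow_of_nonpos (by positivity) hk1 (by linarith))
    _ = ∑' k : ℕ, ∫⁻ u in Metric.ball (0 : Cn n) 1,
          ENNReal.ofReal ((2 ^ k * δ) ^ (-m)) * (A k).indicator (wt s) u :=
        lintegral_tsum fun k =>
          (((measurable_wt s).indicator (hmeas k)).const_mul _).aemeasurable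
    _ ≤ ∑' k : ℕ, C * ENNReal.ofReal (2 ^ (n + 1 + s) * 2 ^ t) * wt (-t) z *
          ENNReal.ofReal ((2 ^ (-t)) ^ k) := by
        refine ENNReal.tsum_le_tsum fun k => ?_
        rw [lintegral_const_mul _ ((measurable_wt s).indicator (hmeas k)),
          setLIntegral_indicator (hmeas k)]
        have hsub : A k ∩ Metric.ball 0 1 = A k :=
          Set.inter_eq_left.2 fun u hu => hu.1
        rw [hsub]
        refine (mul_le_mul_right (h z hz _ (by positivity)) _).trans ?_
        have hD : 0 < 1 - ‖z‖ ^ 2 := one_sub_sq_pos hz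
        have hδt : δ ^ (-t) ≤ 2 ^ t * (1 - ‖z‖ ^ 2) ^ (-t) := by
          have h1 : (1 - ‖z‖ ^ 2) / 2 ≤ δ := by nlinarith [sq_nonneg (1 - ‖z‖)]
          calc δ ^ (-t) ≤ ((1 - ‖z‖ ^ 2) / 2) ^ (-t) :=
                Real.rpow_le_rpow_of_nonpos (by positivity) h1 (by linarith)
            _ = _ := by
                rw [Real.div_rpow hD.le zero_le_two, Real.rpow_neg zero_le_two, div_inv_eq_mul,
                  mul_comm]
        have hreal : (2 ^ k * δ) ^ (-m) * (2 ^ (k + 1) * δ) ^ (n + 1 + s) ≤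
            2 ^ (n + 1 + s) * 2 ^ t * (1 - ‖z‖ ^ 2) ^ (-t) * (2 ^ (-t)) ^ k := by
          have h1 : (2 : ℝ) ^ (k + 1) * δ = 2 * (2 ^ k * δ) := by ring
          have hpos : 0 < (2 : ℝ) ^ k * δ := by positivity
          have h2 : (2 ^ k * δ) ^ (-m) * (2 ^ (k + 1) * δ) ^ (n + 1 + s) =
              2 ^ (n + 1 + s) * ((2 ^ (-t)) ^ k * δ ^ (-t)) := by
            rw [h1, Real.mul_rpow zero_le_two hpos.le, mul_left_comm, ← Real.rpow_add hpos,
              show -m + (n + 1 + s) = -t by rw [hm]; ring,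
              Real.mul_rpow (by positivity) hδ0.le, ← Real.rpow_natCast, ← Real.rpow_natCast,
              ← Real.rpow_mul zero_le_two, ← Real.rpow_mul zero_le_two, mul_comm (-t)]
          rw [h2]
          calc (2 : ℝ) ^ (n + 1 + s) * ((2 ^ (-t)) ^ k * δ ^ (-t))
              ≤ 2 ^ (n + 1 + s) * ((2 ^ (-t)) ^ k * (2 ^ t * (1 - ‖z‖ ^ 2) ^ (-t))) := by gcongr
            _ = _ := by ring
        calc ENNReal.ofReal ((2 ^ k * δ) ^ (-m)) *
              (C * ENNReal.ofReal ((2 ^ (k + 1) * δ) ^ (n + 1 + s)))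
            = C * ENNReal.ofReal ((2 ^ k * δ) ^ (-m) * (2 ^ (k + 1) * δ) ^ (n + 1 + s)) := by
              rw [ENNReal.ofReal_mul (by positivity)]; ring
          _ ≤ C * ENNReal.ofReal
                (2 ^ (n + 1 + s) * 2 ^ t * (1 - ‖z‖ ^ 2) ^ (-t) * (2 ^ (-t)) ^ k) := by
              gcongr
          _ = _ := by
              rw [ENNReal.ofReal_mul (by positivity), ENNReal.ofReal_mul (by positivity), wt]
              ring
    _ = _ := by rw [ENNReal.tsum_mul_left]; ring

/-! ### The measures on the ball and the calculus of weights -/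

instance isFiniteMeasure_normVol : IsFiniteMeasure (normVol n) := by
  refine ⟨?_⟩
  rw [normVol, Measure.smul_apply, Measure.restrict_apply_univ, smul_eq_mul]
  refine ENNReal.mul_lt_top (ENNReal.inv_lt_top.2 ?_) measure_ball_lt_top
  exact Metric.measure_ball_pos volume _ one_pos

theorem lintegral_normVol (f : Cn n → ℝ≥0∞) :
    ∫⁻ z, f z ∂normVol n =
      (volume (Metric.ball (0 : Cn n) 1))⁻¹ * ∫⁻ z in Metric.ball (0 : Cn n) 1, f z := by
  rw [normVol, lintegral_smul_measure, smul_eq_mul]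

theorem volume_ball_inv_ne_top : (volume (Metric.ball (0 : Cn n) 1))⁻¹ ≠ ∞ :=
  ENNReal.inv_ne_top.2 (Metric.measure_ball_pos volume _ one_pos).ne'

theorem volume_ball_inv_ne_zero : (volume (Metric.ball (0 : Cn n) 1))⁻¹ ≠ 0 :=
  ENNReal.inv_ne_zero.2 measure_ball_lt_top.ne

theorem ae_mem_ball : ∀ᵐ z ∂normVol n, z ∈ Metric.ball (0 : Cn n) 1 := by
  unfold normVol
  exact Measure.ae_smul_measure (ae_restrict_mem measurableSet_ball) _

theorem weightConst_pos {θ : ℝ} (hθ : -1 < θ) : 0 < weightConst n θ := by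
  have hn : (0 : ℝ) ≤ n := Nat.cast_nonneg n
  unfold weightConst
  have h1 := Real.Gamma_pos_of_pos (show 0 < n + θ + 1 by linarith)
  have h2 := Real.Gamma_pos_of_pos (show 0 < θ + 1 by linarith)
  positivity

theorem lintegral_weightedVol {θ : ℝ} (hθ : -1 < θ) {f : Cn n → ℝ≥0∞} (hf : Measurable f) :
    ∫⁻ z, f z ∂weightedVol n θ =
      ENNReal.ofReal (weightConst n θ) * ∫⁻ z, wt θ z * f z ∂normVol n := by
  rw [weightedVol, lintegral_withDensity_eq_lintegral_mul _ (by fun_prop) hf,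
    ← lintegral_const_mul' _ _ ENNReal.ofReal_ne_top]
  refine lintegral_congr fun z => ?_
  rw [Pi.mul_apply, ENNReal.ofReal_mul (weightConst_pos hθ).le, wt, mul_assoc]

theorem norm_one_sub_inner_pos {z u : Cn n} (hz : z ∈ Metric.ball (0 : Cn n) 1)
    (hu : u ∈ Metric.ball (0 : Cn n) 1) : 0 < ‖1 - inner ℂ u z‖ := by
  have hz1 : ‖z‖ < 1 := by simpa using hz
  have hu1 : ‖u‖ < 1 := by simpa using hu
  have h1 := one_sub_le_norm_one_sub (ω := inner ℂ u z)
  have h2 := norm_inner_le_of_mem_ball (z := z) hu1.le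
  linarith

theorem kerPow_comm (s : ℝ) (z u : Cn n) : kerPow s z u = kerPow s u z := by
  unfold kerPow
  rw [← Complex.norm_conj, map_sub, map_one, inner_conj_symm]

theorem wt_mul_wt {z : Cn n} (hz : z ∈ Metric.ball (0 : Cn n) 1) (s t : ℝ) :
    wt s z * wt t z = wt (s + t) z := by
  have h := one_sub_sq_pos hz
  rw [wt, wt, wt, ← ENNReal.ofReal_mul (by positivity), Real.rpow_add h]

theorem wt_rpow {z : Cn n} (hz : z ∈ Metric.ball (0 : Cn n) 1) (s r : ℝ) :
    wt s z ^ r = wt (s * r) z := by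
  have h := one_sub_sq_pos hz
  rw [wt, wt, ENNReal.ofReal_rpow_of_pos (by positivity), ← Real.rpow_mul h.le]

theorem wt_ne_top {s : ℝ} {z : Cn n} : wt s z ≠ ∞ := ENNReal.ofReal_ne_top

theorem wt_ne_zero {z : Cn n} (hz : z ∈ Metric.ball (0 : Cn n) 1) (s : ℝ) : wt s z ≠ 0 := by
  have h := one_sub_sq_pos hz
  simpa [wt] using Real.rpow_pos_of_pos h s

theorem wt_zero {z : Cn n} : wt 0 z = 1 := by simp [wt]

theorem kerPow_mul_kerPow {z u : Cn n} (hz : z ∈ Metric.ball (0 : Cn n) 1)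
    (hu : u ∈ Metric.ball (0 : Cn n) 1) (s t : ℝ) :
    kerPow s z u * kerPow t z u = kerPow (s + t) z u := by
  have h := norm_one_sub_inner_pos hz hu
  rw [kerPow, kerPow, kerPow, ← ENNReal.ofReal_mul (by positivity), Real.rpow_add h]

theorem kerPow_rpow {z u : Cn n} (hz : z ∈ Metric.ball (0 : Cn n) 1)
    (hu : u ∈ Metric.ball (0 : Cn n) 1) (s r : ℝ) :
    kerPow s z u ^ r = kerPow (s * r) z u := by
  have h := norm_one_sub_inner_pos hz hu
  rw [kerPow, kerPow, ENNReal.ofReal_rpow_of_pos (by positivity), ← Real.rpow_mul h.le]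

theorem kerPow_le_of_le {z u : Cn n} (hz : z ∈ Metric.ball (0 : Cn n) 1)
    (hu : u ∈ Metric.ball (0 : Cn n) 1) {s t : ℝ} (hst : s ≤ t) :
    kerPow t z u ≤ ENNReal.ofReal (2 ^ (t - s)) * kerPow s z u := by
  have h := norm_one_sub_inner_pos hz hu
  rw [kerPow, kerPow, ← ENNReal.ofReal_mul (by positivity)]
  refine ENNReal.ofReal_le_ofReal ?_
  calc ‖1 - inner ℂ u z‖ ^ t = ‖1 - inner ℂ u z‖ ^ (t - s) * ‖1 - inner ℂ u z‖ ^ s := by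
        rw [← Real.rpow_add h, sub_add_cancel]
    _ ≤ _ := by
        gcongr
        exact (norm_one_sub_inner_lt_two hz hu).le

theorem exists_forelliRudin_normVol_le (hn : 1 ≤ n) {s t : ℝ} (hs : -1 < s) (ht : 0 < t) :
    ∃ C : ℝ≥0∞, C ≠ ∞ ∧ ∀ z ∈ Metric.ball (0 : Cn n) 1,
      ∫⁻ u, wt s u * kerPow (-(n + 1 + s + t)) z u ∂normVol n ≤ C * wt (-t) z := by
  obtain ⟨C, hC, h⟩ := exists_forelliRudin_le hn hs ht
  refine ⟨(volume (Metric.ball (0 : Cn n) 1))⁻¹ * C,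
    ENNReal.mul_ne_top volume_ball_inv_ne_top hC, fun z hz => ?_⟩
  rw [lintegral_normVol, mul_assoc]
  exact mul_le_mul_right (h z hz) _

end ForelliRudin

/-! ### Schur's test -/

/-- **Schur's test** for a positive kernel `k₁ k₂`, from `L^p` to `L^q` with `1 < p ≤ q`. -/
theorem lintegral_schur_test {α β : Type*} [MeasurableSpace α] [MeasurableSpace β]
    {μ : Measure α} {ν : Measure β} [IsFiniteMeasure μ] [SFinite ν] {p p' q : ℝ}
    (hpp' : p.HolderConjugate p') (hpq : p ≤ q) {k₁ k₂ : α → β → ℝ≥0∞} {h : α → ℝ≥0∞}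
    (hk₁ : Measurable (Function.uncurry k₁)) (hk₂ : Measurable (Function.uncurry k₂))
    (hh : Measurable h) {C₁ C₂ : ℝ≥0∞}
    (h₁ : ∀ᵐ x ∂μ, ∫⁻ y, k₁ x y ^ p' ∂ν ≤ C₁ * h x ^ p')
    (h₂ : ∀ᵐ y ∂ν, ∫⁻ x, (h x * k₂ x y) ^ q ∂μ ≤ C₂)
    {F : β → ℝ≥0∞} (hF : Measurable F) :
    (∫⁻ x, (∫⁻ y, k₁ x y * k₂ x y * F y ∂ν) ^ q ∂μ) ^ (1 / q) ≤
      C₁ ^ (1 / p') * C₂ ^ (1 / q) * (∫⁻ y, F y ^ p ∂ν) ^ (1 / p) := by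
  have hp0 : 0 < p := hpp'.pos
  have hp'0 : 0 < p' := hpp'.symm.pos
  have hq0 : 0 < q := hp0.trans_le hpq
  have hr : 1 ≤ q / p := (one_le_div hp0).2 hpq
  -- The integrand left after Hölder in y with exponents p and p'. Its y-integral is raised to the
  -- power q/p, and Minkowski then brings the x-integral inside, where `h₂` applies.
  set Φ : α → β → ℝ≥0∞ := fun x y => (h x * k₂ x y * F y) ^ p with hΦ
  have hΦm : Measurable (Function.uncurry Φ) :=
    (((hh.comp measurable_fst).mul hk₂).mul (hF.comp measurable_snd)).pow_const p
  have hpt : ∀ᵐ x ∂μ, (∫⁻ y, k₁ x y * k₂ x y * F y ∂ν) ^ q ≤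
      (C₁ ^ (1 / p')) ^ q * (∫⁻ y, Φ x y ∂ν) ^ (q / p) := by
    filter_upwards [h₁] with x hx
    have hkx : Measurable fun y => k₁ x y := hk₁.comp measurable_prodMk_left
    have hkx2 : Measurable fun y => k₂ x y := hk₂.comp measurable_prodMk_left
    have hk2F : Measurable fun y => k₂ x y * F y := hkx2.mul hF
    have step : ∫⁻ y, k₁ x y * k₂ x y * F y ∂ν ≤ C₁ ^ (1 / p') * (∫⁻ y, Φ x y ∂ν) ^ (1 / p) := by
      calc ∫⁻ y, k₁ x y * k₂ x y * F y ∂ν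
          = ∫⁻ y, ((fun y => k₂ x y * F y) * fun y => k₁ x y) y ∂ν := by
            refine lintegral_congr fun y => ?_
            simp only [Pi.mul_apply]; ring
        _ ≤ (∫⁻ y, (k₂ x y * F y) ^ p ∂ν) ^ (1 / p) * (∫⁻ y, k₁ x y ^ p' ∂ν) ^ (1 / p') :=
            ENNReal.lintegral_mul_le_Lp_mul_Lq ν hpp' hk2F.aemeasurable hkx.aemeasurable
        _ ≤ (∫⁻ y, (k₂ x y * F y) ^ p ∂ν) ^ (1 / p) * (C₁ * h x ^ p') ^ (1 / p') := by
            gcongr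
        _ = C₁ ^ (1 / p') * (∫⁻ y, Φ x y ∂ν) ^ (1 / p) := by
            have e1 : ∫⁻ y, Φ x y ∂ν = h x ^ p * ∫⁻ y, (k₂ x y * F y) ^ p ∂ν := by
              rw [← lintegral_const_mul _ (hk2F.pow_const p)]
              refine lintegral_congr fun y => ?_
              simp only [hΦ]
              rw [← ENNReal.mul_rpow_of_nonneg _ _ hp0.le, mul_assoc]
            rw [e1, ENNReal.mul_rpow_of_nonneg _ _ (by positivity : 0 ≤ 1 / p'),
              ENNReal.mul_rpow_of_nonneg _ _ (by positivity : 0 ≤ 1 / p), ← ENNReal.rpow_mul,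
              ← ENNReal.rpow_mul, mul_one_div_cancel hp0.ne', mul_one_div_cancel hp'0.ne',
              ENNReal.rpow_one]
            ring
    calc _ ≤ (C₁ ^ (1 / p') * (∫⁻ y, Φ x y ∂ν) ^ (1 / p)) ^ q := by gcongr
      _ = _ := by
          rw [ENNReal.mul_rpow_of_nonneg _ _ hq0.le, ← ENNReal.rpow_mul _ (1 / p) q]
          congr 2; ring
  have hmink := lintegral_minkowski (μ := μ) (ν := ν) hr hΦm
  calc (∫⁻ x, (∫⁻ y, k₁ x y * k₂ x y * F y ∂ν) ^ q ∂μ) ^ (1 / q)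
      ≤ (∫⁻ x, (C₁ ^ (1 / p')) ^ q * (∫⁻ y, Φ x y ∂ν) ^ (q / p) ∂μ) ^ (1 / q) := by
        gcongr 1
        exact lintegral_mono_ae hpt
    _ = C₁ ^ (1 / p') * ((∫⁻ x, (∫⁻ y, Φ x y ∂ν) ^ (q / p) ∂μ) ^ (1 / (q / p))) ^ (1 / p) := by
        have hm : Measurable fun x => (∫⁻ y, Φ x y ∂ν) ^ (q / p) :=
          hΦm.lintegral_prod_right'.pow_const _
        rw [lintegral_const_mul _ hm, ENNReal.mul_rpow_of_nonneg _ _ (by positivity : 0 ≤ 1 / q), ← ENNReal.rpow_mul _ q,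
          mul_one_div_cancel hq0.ne', ENNReal.rpow_one, ← ENNReal.rpow_mul]
        congr 2
        field_simp
    _ ≤ C₁ ^ (1 / p') * (∫⁻ y, (∫⁻ x, Φ x y ^ (q / p) ∂μ) ^ (1 / (q / p)) ∂ν) ^ (1 / p) := by
        gcongr
    _ ≤ C₁ ^ (1 / p') * (∫⁻ y, C₂ ^ (p / q) * F y ^ p ∂ν) ^ (1 / p) := by
        gcongr 2
        refine lintegral_mono_ae ?_
        filter_upwards [h₂] with y hy
        have hkx2 : Measurable fun x => k₂ x y := hk₂.comp measurable_prodMk_right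
        have e2 : ∫⁻ x, Φ x y ^ (q / p) ∂μ = (∫⁻ x, (h x * k₂ x y) ^ q ∂μ) * F y ^ q := by
          have hm : Measurable fun x => (h x * k₂ x y) ^ q := (hh.mul hkx2).pow_const q
          rw [← lintegral_mul_const _ hm]
          refine lintegral_congr fun x => ?_
          simp only [hΦ]
          rw [← ENNReal.rpow_mul, ← ENNReal.mul_rpow_of_nonneg _ _ hq0.le,
            mul_div_cancel₀ _ hp0.ne']
        rw [e2, one_div_div, ENNReal.mul_rpow_of_nonneg _ _ (by positivity), ← ENNReal.rpow_mul,
          mul_div_cancel₀ _ hq0.ne']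
        gcongr
    _ = _ := by
        rw [lintegral_const_mul _ (hF.pow_const p),
          ENNReal.mul_rpow_of_nonneg _ _ (by positivity : 0 ≤ 1 / p), ← ENNReal.rpow_mul, mul_assoc]
        congr 3
        field_simp

namespace ForelliRudin

variable {n : ℕ}

/-! ### The one-variable bound -/

theorem measurable_opKernel (a b c : ℝ) :
    Measurable fun x : Cn n × Cn n => wt a x.1 * wt b x.2 * kerPow c x.1 x.2 :=
  (((measurable_wt a).comp measurable_fst).mul ((measurable_wt b).comp measurable_snd)).mul
    (measurable_kerPow c)

/-- The `L^p → L^q` bound with the critical exponent and without weights in the measures. -/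
theorem exists_critical_bound (hn : 1 ≤ n) {p q A B : ℝ} (hp : 1 < p) (hpq : p ≤ q)
    (hA : 0 < A + 1 / q) (hB : 0 < B + (1 - 1 / p)) :
    ∃ C : ℝ≥0∞, C ≠ ∞ ∧ ∀ F : Cn n → ℝ≥0∞, Measurable F →
      (∫⁻ z, (∫⁻ u, wt A z * wt B u *
        kerPow (-((n + 1) * (1 / q + (1 - 1 / p)) + A + B)) z u * F u ∂normVol n) ^ q
          ∂normVol n) ^ (1 / q) ≤ C * (∫⁻ u, F u ^ p ∂normVol n) ^ (1 / p) := by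
  have hp0 : 0 < p := by linarith
  have hq0 : 0 < q := by linarith
  set P : ℝ := p / (p - 1) with hP
  have hpP : p.HolderConjugate P := by
    simpa [Real.conjExponent] using Real.HolderConjugate.conjExponent hp
  have hP0 : 0 < P := hpP.symm.pos
  have hPinv : 1 - 1 / p = 1 / P := by
    have : p - 1 ≠ 0 := by linarith
    rw [hP]; field_simp
  rw [hPinv] at hB ⊢
  -- Here x is the midpoint of (-1/P, B) and y below the midpoint of (0, A + 1/q), both nonempty by
  -- hypothesis. So all four parameters xP, yP, (A - y)q, (B - x)q fall in the Forelli–Rudin range.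
  set x : ℝ := (B - 1 / P) / 2 with hx
  set y : ℝ := (A + 1 / q) / 2 with hy
  have hx1 : -1 < x * P := by
    have : -(1 / P) < x := by rw [hx]; linarith
    calc (-1 : ℝ) = -(1 / P) * P := by field_simp
      _ < x * P := by gcongr
  have hy0 : 0 < y * P := by rw [hy]; positivity
  have hy1 : -1 < (A - y) * q := by
    have : -(1 / q) < A - y := by rw [hy]; linarith
    calc (-1 : ℝ) = -(1 / q) * q := by field_simp
      _ < (A - y) * q := by gcongr
  have hBx : 0 < (B - x) * q := by
    have : 0 < B - x := by rw [hx]; linarith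
    positivity
  obtain ⟨C₁, hC₁, h₁⟩ := exists_forelliRudin_normVol_le hn hx1 hy0
  obtain ⟨C₂, hC₂, h₂⟩ := exists_forelliRudin_normVol_le hn hy1 hBx
  -- The critical exponent is c₁ + c₂. Each part is fixed by requiring its P-th, respectively q-th,
  -- power to be a Forelli–Rudin kernel.
  set c₁ : ℝ := (n + 1) / P + x + y with hc₁
  set c₂ : ℝ := (n + 1) / q + (A - y) + (B - x) with hc₂
  have hc₁P : -c₁ * P = -(n + 1 + x * P + y * P) := by rw [hc₁]; field_simp
  have hc₂q : -c₂ * q = -(n + 1 + (A - y) * q + (B - x) * q) := by rw [hc₂]; field_simp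
  refine ⟨C₁ ^ (1 / P) * C₂ ^ (1 / q), ENNReal.mul_ne_top
    (ENNReal.rpow_ne_top_of_nonneg (by positivity) hC₁)
    (ENNReal.rpow_ne_top_of_nonneg (by positivity) hC₂), fun F hF => ?_⟩
  have hk₁ : Measurable (Function.uncurry fun z u : Cn n => wt x u * kerPow (-c₁) z u) :=
    ((measurable_wt x).comp measurable_snd).mul (measurable_kerPow _)
  have hk₂ : Measurable (Function.uncurry
      fun z u : Cn n => wt A z * wt (B - x) u * kerPow (-c₂) z u) := measurable_opKernel _ _ _
  have hschur := lintegral_schur_test (μ := normVol n) (ν := normVol n) (C₁ := C₁) (C₂ := C₂)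
    hpP hpq hk₁ hk₂ (measurable_wt (-y)) ?_ ?_ hF
  · refine le_trans (le_of_eq ?_) hschur
    congr 1
    refine lintegral_congr_ae ?_
    filter_upwards [ae_mem_ball] with z hz
    congr 1
    refine lintegral_congr_ae ?_
    filter_upwards [ae_mem_ball] with u hu
    have e1 : wt B u = wt x u * wt (B - x) u := by rw [wt_mul_wt hu]; congr 1; ring
    have e2 : kerPow (-((n + 1) * (1 / q + 1 / P) + A + B)) z u =
        kerPow (-c₁) z u * kerPow (-c₂) z u := by
      rw [kerPow_mul_kerPow hz hu, hc₁, hc₂]; congr 1; ring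
    rw [e1, e2]; ring
  · filter_upwards [ae_mem_ball] with z hz
    rw [wt_rpow hz, neg_mul]
    refine le_trans (lintegral_mono_ae ?_) (h₁ z hz)
    filter_upwards [ae_mem_ball] with u hu
    rw [ENNReal.mul_rpow_of_nonneg _ _ hP0.le, wt_rpow hu, kerPow_rpow hz hu, hc₁P]
  · filter_upwards [ae_mem_ball] with u hu
    calc ∫⁻ z, (wt (-y) z * (wt A z * wt (B - x) u * kerPow (-c₂) z u)) ^ q ∂normVol n
        = ∫⁻ z, wt ((B - x) * q) u * (wt ((A - y) * q) z *
            kerPow (-(n + 1 + (A - y) * q + (B - x) * q)) u z) ∂normVol n := by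
          refine lintegral_congr_ae ?_
          filter_upwards [ae_mem_ball] with z hz
          rw [show wt (-y) z * (wt A z * wt (B - x) u * kerPow (-c₂) z u) =
            wt (B - x) u * ((wt A z * wt (-y) z) * kerPow (-c₂) z u) by ring, wt_mul_wt hz,
            ENNReal.mul_rpow_of_nonneg _ _ hq0.le, ENNReal.mul_rpow_of_nonneg _ _ hq0.le,
            wt_rpow hu, wt_rpow hz, kerPow_rpow hz hu, hc₂q, kerPow_comm, ← sub_eq_add_neg]
      _ ≤ wt ((B - x) * q) u * (C₂ * wt (-((B - x) * q)) u) := by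
          rw [lintegral_const_mul' _ _ wt_ne_top]
          exact mul_le_mul_right (h₂ u hu) _
      _ = C₂ := by
          rw [mul_left_comm, wt_mul_wt hu, add_neg_cancel, wt_zero, mul_one]

/-- The conditions on one coordinate in the boundedness theorem. -/
def CoordCond (n : ℕ) (a b c p q α β : ℝ) : Prop :=
  -(q * a) < β + 1 ∧ α + 1 < p * (b + 1) ∧
    c ≤ n + 1 + a + b + (n + 1 + β) / q - (n + 1 + α) / p

/-- Boundedness of the positive operator in one variable. -/
theorem exists_oneVar_bound (hn : 1 ≤ n) {a b c p q α β : ℝ} (hp : 1 < p) (hpq : p ≤ q)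
    (hα : -1 < α) (hβ : -1 < β) (hcond : CoordCond n a b c p q α β) :
    ∃ C : ℝ≥0∞, C ≠ ∞ ∧ ∀ F : Cn n → ℝ≥0∞, Measurable F →
      (∫⁻ z, (∫⁻ u, wt a z * wt b u * kerPow (-c) z u * F u ∂normVol n) ^ q
          ∂weightedVol n β) ^ (1 / q) ≤ C * (∫⁻ u, F u ^ p ∂weightedVol n α) ^ (1 / p) := by
  obtain ⟨h1, h2, h3⟩ := hcond
  have hp0 : 0 < p := by linarith
  have hq0 : 0 < q := by linarith
  -- The densities of both measures are absorbed: (1 - |z|²)^(β/q) joins the outer weight, and F is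
  -- replaced by (1 - |u|²)^(α/p) F.
  set A : ℝ := a + β / q with hA
  set B : ℝ := b - α / p with hB
  have hA0 : 0 < A + 1 / q := by
    have : A + 1 / q = (q * a + (β + 1)) / q := by rw [hA]; field_simp; ring
    rw [this]; exact div_pos (by linarith) hq0
  have hB0 : 0 < B + (1 - 1 / p) := by
    have : B + (1 - 1 / p) = (p * (b + 1) - (α + 1)) / p := by rw [hB]; field_simp; ring
    rw [this]; exact div_pos (by linarith) hp0
  obtain ⟨C, hC, h⟩ := exists_critical_bound hn hp hpq hA0 hB0
  set c' : ℝ := (n + 1) * (1 / q + (1 - 1 / p)) + A + B with hc'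
  have hcc' : c ≤ c' := by
    refine h3.trans (le_of_eq ?_)
    rw [hc', hA, hB]; field_simp; ring
  set W : ℝ≥0∞ := ENNReal.ofReal (weightConst n β) with hW
  set V : ℝ≥0∞ := ENNReal.ofReal (weightConst n α) with hV
  -- The cost of raising c to the critical c': |1 - ⟨z,u⟩|^(c' - c) ≤ 2^(c' - c).
  set K : ℝ≥0∞ := ENNReal.ofReal (2 ^ (-c - -c')) with hK
  have hV0 : V ≠ 0 := by
    rw [hV]; simpa using weightConst_pos hα
  have hVt : V ≠ ∞ := ENNReal.ofReal_ne_top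
  refine ⟨W ^ (1 / q) * (K * C) * (V ^ (1 / p))⁻¹, ?_, fun F hF => ?_⟩
  · refine ENNReal.mul_ne_top (ENNReal.mul_ne_top (ENNReal.rpow_ne_top_of_nonneg (by positivity)
      ENNReal.ofReal_ne_top) (ENNReal.mul_ne_top ENNReal.ofReal_ne_top hC)) ?_
    rw [ENNReal.inv_ne_top]
    exact (ENNReal.rpow_pos (pos_iff_ne_zero.2 hV0) hVt).ne'
  have hmeas : Measurable fun z => ∫⁻ u, wt a z * wt b u * kerPow (-c) z u * F u ∂normVol n :=
    Measurable.lintegral_prod_right' (f := fun x : Cn n × Cn n =>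
      wt a x.1 * wt b x.2 * kerPow (-c) x.1 x.2 * F x.2)
      ((measurable_opKernel a b (-c)).mul (hF.comp measurable_snd))
  have hG : Measurable fun u => wt (α / p) u * F u := (measurable_wt _).mul hF
  have hmain := h (fun u => wt (α / p) u * F u) hG
  rw [lintegral_weightedVol hβ (hmeas.pow_const q),
    lintegral_weightedVol hα (hF.pow_const p)]
  have e1 : ∫⁻ u, (wt (α / p) u * F u) ^ p ∂normVol n = ∫⁻ u, wt α u * F u ^ p ∂normVol n := by
    refine lintegral_congr_ae ?_
    filter_upwards [ae_mem_ball] with u hu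
    rw [ENNReal.mul_rpow_of_nonneg _ _ hp0.le, wt_rpow hu, div_mul_cancel₀ _ hp0.ne']
  have e2 : ∫⁻ z, wt β z * (∫⁻ u, wt a z * wt b u * kerPow (-c) z u * F u ∂normVol n) ^ q
        ∂normVol n ≤
      K ^ q * ∫⁻ z, (∫⁻ u, wt A z * wt B u * kerPow (-c') z u *
        (wt (α / p) u * F u) ∂normVol n) ^ q ∂normVol n := by
    rw [← lintegral_const_mul]
    · refine lintegral_mono_ae ?_
      filter_upwards [ae_mem_ball] with z hz
      have e3 : wt β z = wt (β / q) z ^ q := by rw [wt_rpow hz, div_mul_cancel₀ _ hq0.ne']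
      rw [e3, ← ENNReal.mul_rpow_of_nonneg _ _ hq0.le, ← ENNReal.mul_rpow_of_nonneg _ _ hq0.le]
      refine ENNReal.rpow_le_rpow ?_ hq0.le
      rw [← lintegral_const_mul' _ _ wt_ne_top,
        ← lintegral_const_mul' _ _ (ENNReal.ofReal_ne_top)]
      refine lintegral_mono_ae ?_
      filter_upwards [ae_mem_ball] with u hu
      have e4 : wt b u = wt B u * wt (α / p) u := by
        rw [wt_mul_wt hu, hB, sub_add_cancel]
      have e5 : wt A z = wt a z * wt (β / q) z := by rw [wt_mul_wt hz]
      calc _ = wt A z * wt B u * kerPow (-c) z u * (wt (α / p) u * F u) := by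
            rw [e4, e5]; ring
        _ ≤ wt A z * wt B u * (K * kerPow (-c') z u) * (wt (α / p) u * F u) := by
            gcongr
            exact kerPow_le_of_le hz hu (by linarith)
        _ = _ := by ring
    · exact (Measurable.lintegral_prod_right' (f := fun x : Cn n × Cn n =>
        wt A x.1 * wt B x.2 * kerPow (-c') x.1 x.2 * (wt (α / p) x.2 * F x.2))
        ((measurable_opKernel A B (-c')).mul (hG.comp measurable_snd))).pow_const q
  calc _ ≤ (W * (K ^ q * ∫⁻ z, (∫⁻ u, wt A z * wt B u * kerPow (-c') z u *
        (wt (α / p) u * F u) ∂normVol n) ^ q ∂normVol n)) ^ (1 / q) := by gcongr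
    _ = W ^ (1 / q) * (K * (∫⁻ z, (∫⁻ u, wt A z * wt B u * kerPow (-c') z u *
        (wt (α / p) u * F u) ∂normVol n) ^ q ∂normVol n) ^ (1 / q)) := by
        rw [ENNReal.mul_rpow_of_nonneg _ _ (by positivity : 0 ≤ 1 / q),
          ENNReal.mul_rpow_of_nonneg _ _ (by positivity : 0 ≤ 1 / q), ← ENNReal.rpow_mul K,
          mul_one_div_cancel hq0.ne', ENNReal.rpow_one]
    _ ≤ W ^ (1 / q) * (K * (C * (∫⁻ u, wt α u * F u ^ p ∂normVol n) ^ (1 / p))) := by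
        rw [← e1]; gcongr
    _ = _ := by
        rw [ENNReal.mul_rpow_of_nonneg _ _ (by positivity : 0 ≤ 1 / p)]
        have hVV : (V ^ (1 / p))⁻¹ * V ^ (1 / p) = 1 :=
          ENNReal.inv_mul_cancel (ENNReal.rpow_pos (pos_iff_ne_zero.2 hV0) hVt).ne'
            (ENNReal.rpow_ne_top_of_nonneg (by positivity) hVt)
        set J := (∫⁻ u, wt α u * F u ^ p ∂normVol n) ^ (1 / p)
        calc _ = W ^ (1 / q) * (K * (C * (1 * J))) := by rw [one_mul]
          _ = W ^ (1 / q) * (K * (C * (((V ^ (1 / p))⁻¹ * V ^ (1 / p)) * J))) := by rw [hVV]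
          _ = _ := by ring

/-! ### Weighted measures, null sets and mixed norms -/

/-- At z = 0 the kernel is identically 1, so this is the Forelli–Rudin estimate at the origin. -/
theorem lintegral_wt_ne_top (hn : 1 ≤ n) {s : ℝ} (hs : -1 < s) :
    ∫⁻ z : Cn n, wt s z ∂normVol n ≠ ∞ := by
  obtain ⟨C, hC, h⟩ := exists_forelliRudin_normVol_le hn hs one_pos
  have h0 := h 0 (by simp)
  have : ∀ u : Cn n, wt s u * kerPow (-(n + 1 + s + 1)) 0 u = wt s u := by simp [kerPow]
  simp only [this] at h0
  refine (h0.trans_lt (ENNReal.mul_lt_top hC.lt_top ?_)).ne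
  exact ENNReal.ofReal_lt_top

theorem isFiniteMeasure_weightedVol (hn : 1 ≤ n) {θ : ℝ} (hθ : -1 < θ) :
    IsFiniteMeasure (weightedVol n θ) := by
  refine ⟨?_⟩
  have h := lintegral_weightedVol hθ (f := fun _ : Cn n => (1 : ℝ≥0∞)) measurable_const
  simp only [lintegral_const, one_mul, mul_one] at h
  rw [h]
  exact ENNReal.mul_lt_top ENNReal.ofReal_lt_top (lintegral_wt_ne_top hn hθ).lt_top

theorem ae_weightedVol_of_ae_normVol {θ : ℝ} {P : Cn n → Prop} (h : ∀ᵐ z ∂normVol n, P z) :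
    ∀ᵐ z ∂weightedVol n θ, P z :=
  (withDensity_absolutelyContinuous _ _).ae_le h

/-- The density is strictly positive on the ball, so the weighted and unweighted measures have the
same null sets. -/
theorem ae_normVol_of_ae_weightedVol {θ : ℝ} (hθ : -1 < θ) {P : Cn n → Prop}
    (h : ∀ᵐ z ∂weightedVol n θ, P z) : ∀ᵐ z ∂normVol n, P z := by
  rw [weightedVol, ae_withDensity_iff (by fun_prop)] at h
  filter_upwards [h, ae_mem_ball] with z hz hzb
  refine hz ?_
  have := Real.rpow_pos_of_pos (one_sub_sq_pos hzb) θ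
  have := weightConst_pos (n := n) hθ
  simp only [ne_eq, ENNReal.ofReal_eq_zero, not_le]
  positivity

theorem ae_prod_mem_ball : ∀ᵐ x ∂(normVol n).prod (normVol n),
    x.1 ∈ Metric.ball (0 : Cn n) 1 ∧ x.2 ∈ Metric.ball (0 : Cn n) 1 :=
  (Measure.quasiMeasurePreserving_fst.ae ae_mem_ball).and
    (Measure.quasiMeasurePreserving_snd.ae ae_mem_ball)

theorem ae_ae_swap_of_ae_prod {P : Cn n × Cn n → Prop}
    (h : ∀ᵐ x ∂(normVol n).prod (normVol n), P x) :
    ∀ᵐ w ∂normVol n, ∀ᵐ z ∂normVol n, P (z, w) := by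
  have h' : ∀ᵐ x ∂(normVol n).prod (normVol n), P x.swap :=
    (Measure.measurePreserving_swap (μ := normVol n) (ν := normVol n)).quasiMeasurePreserving.ae h
  exact Measure.ae_ae_of_ae_prod h'

/-- The mixed norm of a nonnegative function. -/
noncomputable def lmixed (p α : Fin 2 → ℝ) (F : Cn n × Cn n → ℝ≥0∞) : ℝ≥0∞ :=
  (∫⁻ w, (∫⁻ z, F (z, w) ^ p 0 ∂weightedVol n (α 0)) ^ (p 1 / p 0)
    ∂weightedVol n (α 1)) ^ (1 / p 1)

theorem mixedNorm_eq_lmixed (p α : Fin 2 → ℝ) (f : Cn n × Cn n → ℂ) :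
    mixedNorm p α f = lmixed p α fun x => ‖f x‖ₑ := rfl

theorem lmixed_mono_ae {p α : Fin 2 → ℝ} (hp : ∀ i, 0 < p i) {F G : Cn n × Cn n → ℝ≥0∞}
    (h : ∀ᵐ x ∂(normVol n).prod (normVol n), F x ≤ G x) : lmixed p α F ≤ lmixed p α G := by
  have h0 := hp 0
  have h1 := hp 1
  refine ENNReal.rpow_le_rpow (lintegral_mono_ae ?_) (by positivity)
  filter_upwards [ae_weightedVol_of_ae_normVol (ae_ae_swap_of_ae_prod h)] with w hw
  refine ENNReal.rpow_le_rpow (lintegral_mono_ae ?_) (by positivity)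
  filter_upwards [ae_weightedVol_of_ae_normVol hw] with z hz
  exact ENNReal.rpow_le_rpow hz h0.le

theorem lmixed_congr_ae {p α : Fin 2 → ℝ} (hp : ∀ i, 0 < p i) {F G : Cn n × Cn n → ℝ≥0∞}
    (h : F =ᵐ[(normVol n).prod (normVol n)] G) : lmixed p α F = lmixed p α G :=
  le_antisymm (lmixed_mono_ae hp h.le) (lmixed_mono_ae hp h.symm.le)

/-- Turns the norm bound for the positive operator into absolute convergence of the defining
integral at almost every point. -/
theorem ae_lt_top_of_lmixed_lt_top (hn : 1 ≤ n) {p α : Fin 2 → ℝ} (hp : ∀ i, 0 < p i)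
    (hα : ∀ i, -1 < α i) {F : Cn n × Cn n → ℝ≥0∞} (hF : Measurable F) (h : lmixed p α F < ∞) :
    ∀ᵐ x ∂(normVol n).prod (normVol n), F x < ∞ := by
  have := isFiniteMeasure_weightedVol hn (hα 0)
  have h0 := hp 0
  have h1 := hp 1
  have hFs : Measurable fun x : Cn n × Cn n => F x.swap := hF.comp measurable_swap
  have hm : Measurable fun w => ∫⁻ z, F (z, w) ^ p 0 ∂weightedVol n (α 0) :=
    (hFs.pow_const (p 0)).lintegral_prod_right'
  rw [lmixed, ENNReal.rpow_lt_top_iff_of_pos (by positivity)] at h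
  have hw := ae_normVol_of_ae_weightedVol (hα 1) (ae_lt_top (hm.pow_const _) h.ne)
  have key : ∀ᵐ w ∂normVol n, ∀ᵐ z ∂normVol n, F (z, w) < ∞ := by
    filter_upwards [hw] with w hw
    rw [ENNReal.rpow_lt_top_iff_of_pos (by positivity)] at hw
    have hz := ae_normVol_of_ae_weightedVol (hα 0)
      (ae_lt_top ((hF.comp measurable_prodMk_right).pow_const (p 0)) hw.ne)
    filter_upwards [hz] with z hz
    rwa [ENNReal.rpow_lt_top_iff_of_pos h0] at hz
  have hset : MeasurableSet {x : Cn n × Cn n | F x < ∞} := measurableSet_lt hF measurable_const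
  refine (Measure.ae_prod_iff_ae_ae hset).2 ((Measure.ae_ae_comm ?_).2 key)
  exact hset

/-! ### The two-variable bound and sufficiency -/

/-- The positive kernel in one coordinate, including the outer weight. -/
noncomputable def opKernel (a b c : ℝ) (z u : Cn n) : ℝ≥0∞ := wt a z * wt b u * kerPow (-c) z u

theorem measurable_opKernel_comp {X : Type*} [MeasurableSpace X] (a b c : ℝ) {f g : X → Cn n}
    (hf : Measurable f) (hg : Measurable g) : Measurable fun x => opKernel a b c (f x) (g x) := by
  have h1 : Measurable fun x => wt a (f x) := (measurable_wt a).comp hf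
  have h2 : Measurable fun x => wt b (g x) := (measurable_wt b).comp hg
  have h3 : Measurable fun x => kerPow (-c) (f x) (g x) :=
    ((measurable_const.sub (hg.inner hf)).norm.pow_const _).ennreal_ofReal
  exact (h1.mul h2).mul h3

/-- The product kernel lets the one-variable bounds be composed. Minkowski with exponent p₁ ≥ 1
replaces F(·,η) by its inner norm N(η), so the second bound acts on N alone. -/
theorem exists_twoVar_bound (hn : 1 ≤ n) {a b c p q α β : Fin 2 → ℝ} (hp : ∀ i, 1 < p i)
    (hpq : ∀ i, p i ≤ q i) (hα : ∀ i, -1 < α i) (hβ : ∀ i, -1 < β i)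
    (hcond : ∀ i, CoordCond n (a i) (b i) (c i) (p i) (q i) (α i) (β i)) :
    ∃ C : ℝ≥0∞, C ≠ ∞ ∧ ∀ F : Cn n × Cn n → ℝ≥0∞, Measurable F →
      lmixed q β (fun x => ∫⁻ y, opKernel (a 0) (b 0) (c 0) x.1 y.1 *
        opKernel (a 1) (b 1) (c 1) x.2 y.2 * F y ∂(normVol n).prod (normVol n)) ≤
        C * lmixed p α F := by
  obtain ⟨C₀, hC₀, h₀⟩ := exists_oneVar_bound hn (hp 0) (hpq 0) (hα 0) (hβ 0) (hcond 0)
  obtain ⟨C₁, hC₁, h₁⟩ := exists_oneVar_bound hn (hp 1) (hpq 1) (hα 1) (hβ 1) (hcond 1)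
  have := isFiniteMeasure_weightedVol hn (hα 0)
  have hp0 : 0 < p 0 := by linarith [hp 0]
  have hp1 : 0 < p 1 := by linarith [hp 1]
  have hq0 : 0 < q 0 := by linarith [hpq 0]
  have hq1 : 0 < q 1 := by linarith [hpq 1]
  refine ⟨C₀ * C₁, ENNReal.mul_ne_top hC₀ hC₁, fun F hF => ?_⟩
  set k₀ : Cn n → Cn n → ℝ≥0∞ := opKernel (a 0) (b 0) (c 0) with hk₀
  set k₁ : Cn n → Cn n → ℝ≥0∞ := opKernel (a 1) (b 1) (c 1) with hk₁
  have hk₀m : Measurable fun x : Cn n × Cn n => k₀ x.1 x.2 := measurable_opKernel _ _ _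
  have hk₁m : Measurable fun x : Cn n × Cn n => k₁ x.1 x.2 := measurable_opKernel _ _ _
  set N : Cn n → ℝ≥0∞ := fun η => (∫⁻ u, F (u, η) ^ p 0 ∂weightedVol n (α 0)) ^ (1 / p 0) with hN
  have hNm : Measurable N := by
    have hFs : Measurable fun x : Cn n × Cn n => F x.swap := hF.comp measurable_swap
    exact (hFs.pow_const (p 0)).lintegral_prod_right'.pow_const _
  set G : Cn n → Cn n → ℝ≥0∞ := fun w u => ∫⁻ η, k₁ w η * F (u, η) ∂normVol n with hG
  have hGm : ∀ w, Measurable (G w) := fun w =>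
    Measurable.lintegral_prod_right' (f := fun x : Cn n × Cn n => k₁ w x.2 * F x)
      ((hk₁m.comp (measurable_const.prodMk measurable_snd)).mul hF)
  have hop : ∀ z w, ∫⁻ y, k₀ z y.1 * k₁ w y.2 * F y ∂(normVol n).prod (normVol n) =
      ∫⁻ u, k₀ z u * G w u ∂normVol n := by
    intro z w
    have hm : Measurable fun y : Cn n × Cn n => k₀ z y.1 * k₁ w y.2 * F y :=
      ((hk₀m.comp (measurable_const.prodMk measurable_fst)).mul
        (hk₁m.comp (measurable_const.prodMk measurable_snd))).mul hF
    rw [lintegral_prod _ hm.aemeasurable]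
    refine lintegral_congr fun u => ?_
    have hm2 : Measurable fun η => k₁ w η * F (u, η) :=
      (hk₁m.comp measurable_prodMk_left).mul (hF.comp measurable_prodMk_left)
    rw [hG, ← lintegral_const_mul _ hm2]
    simp only [mul_assoc]
  -- For fixed w, the bound in z is applied to u ↦ ∫ k₁(w,η) F(u,η) dυ(η), and Minkowski moves the
  -- norm in u inside that integral.
  have hinner : ∀ w, (∫⁻ z, (∫⁻ y, k₀ z y.1 * k₁ w y.2 * F y ∂(normVol n).prod (normVol n)) ^ q 0
      ∂weightedVol n (β 0)) ^ (1 / q 0) ≤ C₀ * ∫⁻ η, k₁ w η * N η ∂normVol n := by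
    intro w
    simp only [hop]
    refine (h₀ (G w) (hGm w)).trans (mul_le_mul_right ?_ _)
    have hm : Measurable (Function.uncurry fun u η : Cn n => k₁ w η * F (u, η)) :=
      (hk₁m.comp (measurable_const.prodMk measurable_snd)).mul hF
    refine (lintegral_minkowski (hp 0).le hm).trans (le_of_eq ?_)
    refine lintegral_congr fun η => ?_
    have hm2 : Measurable fun u => F (u, η) ^ p 0 := (hF.comp measurable_prodMk_right).pow_const _
    simp only [ENNReal.mul_rpow_of_nonneg _ _ hp0.le]
    rw [lintegral_const_mul _ hm2, ENNReal.mul_rpow_of_nonneg _ _ (by positivity : 0 ≤ 1 / p 0),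
      ← ENNReal.rpow_mul, mul_one_div_cancel hp0.ne', ENNReal.rpow_one]
  have hm3 : Measurable fun w => (∫⁻ η, k₁ w η * N η ∂normVol n) ^ q 1 :=
    (Measurable.lintegral_prod_right' (f := fun x : Cn n × Cn n => k₁ x.1 x.2 * N x.2)
      (hk₁m.mul (hNm.comp measurable_snd))).pow_const _
  calc lmixed q β (fun x => ∫⁻ y, k₀ x.1 y.1 * k₁ x.2 y.2 * F y ∂(normVol n).prod (normVol n))
      ≤ (∫⁻ w, (C₀ * ∫⁻ η, k₁ w η * N η ∂normVol n) ^ q 1 ∂weightedVol n (β 1)) ^ (1 / q 1) := by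
        refine ENNReal.rpow_le_rpow (lintegral_mono fun w => ?_) (by positivity)
        refine le_trans (le_of_eq ?_) (ENNReal.rpow_le_rpow (hinner w) hq1.le)
        rw [← ENNReal.rpow_mul]
        congr 1
        ring
    _ = C₀ * (∫⁻ w, (∫⁻ η, k₁ w η * N η ∂normVol n) ^ q 1 ∂weightedVol n (β 1)) ^ (1 / q 1) := by
        simp only [ENNReal.mul_rpow_of_nonneg _ _ hq1.le]
        rw [lintegral_const_mul _ hm3, ENNReal.mul_rpow_of_nonneg _ _ (by positivity : 0 ≤ 1 / q 1),
          ← ENNReal.rpow_mul, mul_one_div_cancel hq1.ne', ENNReal.rpow_one]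
    _ ≤ C₀ * (C₁ * (∫⁻ η, N η ^ p 1 ∂weightedVol n (α 1)) ^ (1 / p 1)) :=
        mul_le_mul_right (h₁ N hNm) _
    _ = C₀ * C₁ * lmixed p α F := by
        rw [mul_assoc, lmixed]
        congr 4
        ext η
        rw [hN, ← ENNReal.rpow_mul]
        congr 1
        ring

/-- What is used about the kernels `kernelS` and `kernelT`: they are measurable, their modulus is
given by the weights, and they are nearly positive where `1 - ⟨z, u⟩` is close to a positive
number. -/
structure IsNearlyPositiveKernel (b c : Fin 2 → ℝ) (K : Cn n × Cn n → Cn n × Cn n → ℂ) :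
    Prop where
  measurable : Measurable (Function.uncurry K)
  enorm_eq : ∀ x y : Cn n × Cn n, x.1 ∈ Metric.ball 0 1 → x.2 ∈ Metric.ball 0 1 →
    y.1 ∈ Metric.ball 0 1 → y.2 ∈ Metric.ball 0 1 → ‖K x y‖ₑ =
      (wt (b 0) y.1 * kerPow (-c 0) x.1 y.1) * (wt (b 1) y.2 * kerPow (-c 1) x.2 y.2)
  le_re : ∃ ε > 0, ∀ x y : Cn n × Cn n, x.1 ∈ Metric.ball 0 1 → x.2 ∈ Metric.ball 0 1 →
    y.1 ∈ Metric.ball 0 1 → y.2 ∈ Metric.ball 0 1 → ∀ d₀ d₁ : ℝ, 0 < d₀ → 0 < d₁ →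
    ‖(1 - inner ℂ y.1 x.1) / d₀ - 1‖ ≤ ε → ‖(1 - inner ℂ y.2 x.2) / d₁ - 1‖ ≤ ε →
    ‖K x y‖ / 4 ≤ (K x y).re

theorem enorm_one_sub_sq_rpow_mul {x : Cn n × Cn n} (h₁ : x.1 ∈ Metric.ball (0 : Cn n) 1)
    (h₂ : x.2 ∈ Metric.ball (0 : Cn n) 1) (s t : ℝ) :
    ‖(((1 - ‖x.1‖ ^ 2) ^ s * (1 - ‖x.2‖ ^ 2) ^ t : ℝ) : ℂ)‖ₑ = wt s x.1 * wt t x.2 := by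
  have h1 := one_sub_sq_pos h₁
  have h2 := one_sub_sq_pos h₂
  rw [← ofReal_norm, Complex.norm_real, Real.norm_of_nonneg (by positivity),
    ENNReal.ofReal_mul (by positivity), wt, wt]

/-- The modulus of the image is dominated by the positive operator H applied to |f|, so
`exists_twoVar_bound` gives convergence and the norm bound together. -/
theorem isBoundedOp_of_coordCond (hn : 1 ≤ n) {a b c p q α β : Fin 2 → ℝ} (hp : ∀ i, 1 < p i)
    (hpq : ∀ i, p i ≤ q i) (hα : ∀ i, -1 < α i) (hβ : ∀ i, -1 < β i)
    (hcond : ∀ i, CoordCond n (a i) (b i) (c i) (p i) (q i) (α i) (β i))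
    {K : Cn n × Cn n → Cn n × Cn n → ℂ} (hK : IsNearlyPositiveKernel b c K) :
    IsBoundedOp a K p α q β := by
  obtain ⟨C, hC, hbound⟩ := exists_twoVar_bound hn hp hpq hα hβ hcond
  have hp0 : ∀ i, 0 < p i := fun i => by linarith [hp i]
  have hq0 : ∀ i, 0 < q i := fun i => by linarith [hp i, hpq i]
  refine ⟨C.toNNReal, fun f hf => ?_⟩
  rw [ENNReal.coe_toNNReal hC]
  obtain ⟨hfm, hfn⟩ := hf
  -- A strongly measurable representative makes H and the image measurable.
  set g := hfm.mk f with hg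
  have hgm : StronglyMeasurable g := hfm.stronglyMeasurable_mk
  have hfg : f =ᵐ[(normVol n).prod (normVol n)] g := hfm.ae_eq_mk
  have hGm : Measurable fun y => ‖g y‖ₑ := hgm.measurable.enorm
  have hnorm : lmixed p α (fun y => ‖g y‖ₑ) = mixedNorm p α f := by
    rw [mixedNorm_eq_lmixed]
    exact lmixed_congr_ae hp0 (hfg.symm.mono fun x hx => by simp only [hx])
  set H : Cn n × Cn n → ℝ≥0∞ := fun x => ∫⁻ y, opKernel (a 0) (b 0) (c 0) x.1 y.1 *
        opKernel (a 1) (b 1) (c 1) x.2 y.2 * ‖g y‖ₑ ∂(normVol n).prod (normVol n) with hH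
  have hHm : Measurable H := by
    have h0 : Measurable fun x : (Cn n × Cn n) × (Cn n × Cn n) =>
        opKernel (a 0) (b 0) (c 0) x.1.1 x.2.1 :=
      measurable_opKernel_comp _ _ _ (by fun_prop) (by fun_prop)
    have h1 : Measurable fun x : (Cn n × Cn n) × (Cn n × Cn n) =>
        opKernel (a 1) (b 1) (c 1) x.1.2 x.2.2 :=
      measurable_opKernel_comp _ _ _ (by fun_prop) (by fun_prop)
    have h2 : Measurable fun x : (Cn n × Cn n) × (Cn n × Cn n) => ‖g x.2‖ₑ :=
      hGm.comp measurable_snd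
    exact ((h0.mul h1).mul h2).lintegral_prod_right'
  have hHn : lmixed q β H ≤ C * mixedNorm p α f := hnorm ▸ hbound _ hGm
  have hHtop : lmixed q β H < ∞ := hHn.trans_lt (ENNReal.mul_lt_top hC.lt_top hfn)
  have hHx : ∀ x : Cn n × Cn n, x.1 ∈ Metric.ball 0 1 → x.2 ∈ Metric.ball 0 1 →
      H x = wt (a 0) x.1 * wt (a 1) x.2 *
        ∫⁻ y, ‖K x y * f y‖ₑ ∂(normVol n).prod (normVol n) := by
    intro x h1 h2
    rw [← lintegral_const_mul' _ _ (ENNReal.mul_ne_top wt_ne_top wt_ne_top)]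
    refine lintegral_congr_ae ?_
    filter_upwards [ae_prod_mem_ball, hfg] with y hy hfy
    rw [enorm_mul, hK.enorm_eq x y h1 h2 hy.1 hy.2, hfy, opKernel, opKernel]
    ring
  have hle : ∀ᵐ x ∂(normVol n).prod (normVol n), ‖integralOp a K f x‖ₑ ≤ H x := by
    filter_upwards [ae_prod_mem_ball] with x hx
    rw [integralOp, enorm_mul, enorm_one_sub_sq_rpow_mul hx.1 hx.2, hHx x hx.1 hx.2]
    exact mul_le_mul_right (enorm_integral_le_lintegral_enorm _) _
  have hres : mixedNorm q β (integralOp a K f) ≤ C * mixedNorm p α f :=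
    (lmixed_mono_ae hq0 hle).trans hHn
  refine ⟨?_, ⟨?_, hres.trans_lt (ENNReal.mul_lt_top hC.lt_top hfn)⟩, hres⟩
  -- H is the integral of the modulus times nonzero outer weights, so its finiteness gives
  -- integrability.
  · filter_upwards [ae_prod_mem_ball, ae_lt_top_of_lmixed_lt_top hn hq0 hβ hHm hHtop] with x hx hHx'
    refine ⟨((hK.measurable.comp measurable_prodMk_left).aestronglyMeasurable).mul hfm, ?_⟩
    rw [hHx x hx.1 hx.2] at hHx'
    refine lt_of_not_ge fun h => ?_
    rw [top_le_iff.1 h, ENNReal.mul_top (mul_ne_zero (wt_ne_zero hx.1 _) (wt_ne_zero hx.2 _))] at hHx'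
    exact lt_irrefl _ hHx'
  · have hop : integralOp a K f = fun x => (((1 - ‖x.1‖ ^ 2) ^ a 0 * (1 - ‖x.2‖ ^ 2) ^ a 1 : ℝ) : ℂ) *
        ∫ y, K x y * g y ∂(normVol n).prod (normVol n) := by
      ext x
      rw [integralOp]
      congr 1
      exact integral_congr_ae (hfg.mono fun y hy => by simp only [hy])
    rw [hop]
    refine AEStronglyMeasurable.mul ?_ ?_
    · refine Measurable.aestronglyMeasurable ?_
      fun_prop
    · refine StronglyMeasurable.aestronglyMeasurable ?_
      exact StronglyMeasurable.integral_prod_right'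
        (f := fun x : (Cn n × Cn n) × (Cn n × Cn n) => K x.1 x.2 * g x.2)
        (hK.measurable.stronglyMeasurable.mul (hgm.comp_measurable measurable_snd))

/-! ### Near positivity of the kernels of S and T -/

theorem rpow_le_rpow_abs {M y : ℝ} (hM : 1 ≤ M) (hy₁ : M⁻¹ ≤ y) (hy₂ : y ≤ M) (s : ℝ) :
    y ^ s ≤ M ^ |s| := by
  have hM0 : 0 < M := by linarith
  have hy0 : 0 < y := (inv_pos.2 hM0).trans_le hy₁
  rcases le_or_gt 0 s with hs | hs
  · rw [abs_of_nonneg hs]; exact Real.rpow_le_rpow hy0.le hy₂ hs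
  · rw [abs_of_neg hs]
    calc y ^ s ≤ M⁻¹ ^ s := Real.rpow_le_rpow_of_nonpos (inv_pos.2 hM0) hy₁ hs.le
      _ = M ^ (-s) := by rw [Real.inv_rpow hM0.le, Real.rpow_neg hM0.le]

theorem rpow_neg_abs_le_rpow {M y : ℝ} (hM : 1 ≤ M) (hy₁ : M⁻¹ ≤ y) (hy₂ : y ≤ M) (s : ℝ) :
    M ^ (-|s|) ≤ y ^ s := by
  have hM0 : 0 < M := by linarith
  have hy0 : 0 < y := (inv_pos.2 hM0).trans_le hy₁
  have h := rpow_le_rpow_abs hM hy₁ hy₂ (-s)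
  rw [abs_neg, Real.rpow_neg hy0.le] at h
  rw [Real.rpow_neg hM0.le]
  exact inv_le_of_inv_le₀ (Real.rpow_pos_of_pos hy0 s) h

theorem rpow_div_mul {x d : ℝ} (hx : 0 ≤ x) (hd : 0 < d) (s : ℝ) :
    (x / d) ^ s * d ^ s = x ^ s := by
  rw [← Real.mul_rpow (by positivity) hd.le, div_mul_cancel₀ _ hd.ne']

/-- The quotient |1 - ⟨z,u⟩|/d lies in [1/2, 3/2], so a power s of either sign is at least 2^(-|s|).
-/
theorem kerPow_ge {z u : Cn n} {d : ℝ} (hd : 0 < d)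
    (h : ‖(1 - inner ℂ u z) / d - 1‖ ≤ 1 / 2) (s : ℝ) :
    ENNReal.ofReal (2 ^ (-|s|)) * ENNReal.ofReal (d ^ s) ≤ kerPow s z u := by
  set X : ℂ := 1 - inner ℂ u z with hX
  have h1 : ‖X‖ / d = ‖X / d‖ := by
    rw [norm_div, Complex.norm_real, Real.norm_of_nonneg hd.le]
  have h2 : |‖X / (d : ℂ)‖ - 1| ≤ 1 / 2 := by
    have := abs_norm_sub_norm_le (X / (d : ℂ)) 1
    rw [norm_one] at this
    exact this.trans h
  rw [← h1, abs_le] at h2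
  rw [kerPow, ← ENNReal.ofReal_mul (by positivity), ← rpow_div_mul (norm_nonneg X) hd]
  refine ENNReal.ofReal_le_ofReal (mul_le_mul_of_nonneg_right ?_ (by positivity))
  exact rpow_neg_abs_le_rpow one_le_two (by linarith [h2.1]) (by linarith [h2.2]) s

theorem isNearlyPositiveKernel_kernelS (b c : Fin 2 → ℝ) :
    IsNearlyPositiveKernel (n := n) b c (kernelS b c) where
  measurable := by
    unfold kernelS Function.uncurry
    have h1 : Measurable fun x : (Cn n × Cn n) × (Cn n × Cn n) => inner ℂ x.2.1 x.1.1 :=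
      Measurable.inner (by fun_prop) (by fun_prop)
    have h2 : Measurable fun x : (Cn n × Cn n) × (Cn n × Cn n) => inner ℂ x.2.2 x.1.2 :=
      Measurable.inner (by fun_prop) (by fun_prop)
    fun_prop
  enorm_eq x y h1 h2 h3 h4 := by
    have e1 := norm_one_sub_inner_pos h1 h3
    have e2 := norm_one_sub_inner_pos h2 h4
    have e3 := one_sub_sq_pos h3
    have e4 := one_sub_sq_pos h4
    rw [kernelS, ← ofReal_norm, Complex.norm_real, Real.norm_of_nonneg (by positivity), wt, wt,
      kerPow, kerPow, ← ENNReal.ofReal_mul (by positivity), ← ENNReal.ofReal_mul (by positivity),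
      ← ENNReal.ofReal_mul (by positivity), Real.rpow_neg e1.le, Real.rpow_neg e2.le]
    congr 1
    field_simp
  le_re := by
    refine ⟨1, one_pos, fun x y h1 h2 h3 h4 d₀ d₁ _ _ _ _ => ?_⟩
    have e1 := norm_one_sub_inner_pos h1 h3
    have e2 := norm_one_sub_inner_pos h2 h4
    have e3 := one_sub_sq_pos h3
    have e4 := one_sub_sq_pos h4
    rw [kernelS, Complex.norm_real, Complex.ofReal_re, Real.norm_of_nonneg (by positivity)]
    exact div_le_self (by positivity) (by norm_num)

theorem norm_kernelT_eq {b c : Fin 2 → ℝ} (x y : Cn n × Cn n) :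
    ‖kernelT b c x y‖ = ‖kernelS b c x y‖ := by
  rw [kernelT, kernelS, norm_div, norm_mul, Complex.norm_cpow_real, Complex.norm_cpow_real,
    Complex.norm_real, Complex.norm_real, norm_div, norm_mul (‖1 - inner ℂ y.1 x.1‖ ^ c 0),
    Real.norm_of_nonneg (by positivity : 0 ≤ ‖1 - inner ℂ y.1 x.1‖ ^ c 0),
    Real.norm_of_nonneg (by positivity : 0 ≤ ‖1 - inner ℂ y.2 x.2‖ ^ c 1)]

/-- The argument is continuous at 1 and vanishes there. -/
theorem exists_abs_arg_mul_le (M : ℝ) :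
    ∃ ε > 0, ∀ w : ℂ, ‖w - 1‖ ≤ ε → |w.arg| * M ≤ 1 := by
  have hcont : ContinuousAt (fun w : ℂ => |w.arg| * M) 1 :=
    (Complex.continuousAt_arg Complex.one_mem_slitPlane).abs.mul_const M
  have h := hcont.eventually_lt (continuousAt_const (y := (1 : ℝ))) (by simp)
  obtain ⟨ε, hε, hball⟩ := Metric.eventually_nhds_iff.1 h
  refine ⟨ε / 2, by positivity, fun w hw => (hball ?_).le⟩
  rw [dist_eq_norm]
  linarith

/-- Dividing by d > 0 does not change an argument, so the closeness hypothesis controls arg(1 -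
⟨z,u⟩) uniformly, however small d is. The phase of the kernel is a combination of the two arguments
with coefficients -c₁, -c₂. -/
theorem isNearlyPositiveKernel_kernelT (b c : Fin 2 → ℝ) :
    IsNearlyPositiveKernel (n := n) b c (kernelT b c) where
  measurable := by
    unfold kernelT Function.uncurry
    have h1 : Measurable fun x : (Cn n × Cn n) × (Cn n × Cn n) => inner ℂ x.2.1 x.1.1 :=
      Measurable.inner (by fun_prop) (by fun_prop)
    have h2 : Measurable fun x : (Cn n × Cn n) × (Cn n × Cn n) => inner ℂ x.2.2 x.1.2 :=
      Measurable.inner (by fun_prop) (by fun_prop)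
    fun_prop
  enorm_eq x y h1 h2 h3 h4 := by
    rw [← (isNearlyPositiveKernel_kernelS b c).enorm_eq x y h1 h2 h3 h4, ← ofReal_norm,
      norm_kernelT_eq, ofReal_norm]
  le_re := by
    -- The factor 2(|c₁| + |c₂|) gives each coordinate at most 1/2 of phase. The total phase is at
    -- most 1, where the cosine is at least 1/2.
    obtain ⟨ε, hε, h⟩ := exists_abs_arg_mul_le (2 * (|c 0| + |c 1|))
    refine ⟨ε, hε, fun x y h1 h2 h3 h4 d₀ d₁ hd₀ hd₁ hx hy => ?_⟩
    have e1 := norm_one_sub_inner_pos h1 h3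
    have e2 := norm_one_sub_inner_pos h2 h4
    have e3 := one_sub_sq_pos h3
    have e4 := one_sub_sq_pos h4
    set X : ℂ := 1 - inner ℂ y.1 x.1 with hX
    set Y : ℂ := 1 - inner ℂ y.2 x.2 with hY
    have hargX : |X.arg| * (2 * (|c 0| + |c 1|)) ≤ 1 := by
      have := h _ hx
      rwa [div_eq_inv_mul, ← Complex.ofReal_inv, Complex.arg_real_mul _ (inv_pos.2 hd₀)] at this
    have hargY : |Y.arg| * (2 * (|c 0| + |c 1|)) ≤ 1 := by
      have := h _ hy
      rwa [div_eq_inv_mul, ← Complex.ofReal_inv, Complex.arg_real_mul _ (inv_pos.2 hd₁)] at this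
    set r : ℝ := (1 - ‖y.1‖ ^ 2) ^ b 0 * (1 - ‖y.2‖ ^ 2) ^ b 1 with hr
    have hr0 : 0 ≤ r := by positivity
    set w : ℂ := -(Complex.log X * c 0 + Complex.log Y * c 1) with hw
    have hK : kernelT b c x y = r * Complex.exp w := by
      rw [kernelT, ← hX, ← hY, Complex.cpow_def_of_ne_zero (norm_pos_iff.1 e1),
        Complex.cpow_def_of_ne_zero (norm_pos_iff.1 e2), ← Complex.exp_add, hw, Complex.exp_neg,
        div_eq_mul_inv]
    have him : w.im = -(X.arg * c 0 + Y.arg * c 1) := by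
      simp [hw, Complex.log_im]
    have him1 : |w.im| ≤ 1 := by
      rw [him, abs_neg]
      calc |X.arg * c 0 + Y.arg * c 1| ≤ |X.arg| * |c 0| + |Y.arg| * |c 1| := by
            rw [← abs_mul, ← abs_mul]; exact abs_add_le _ _
        _ ≤ 1 := by
            have := mul_nonneg (abs_nonneg X.arg) (abs_nonneg (c 1))
            have := mul_nonneg (abs_nonneg Y.arg) (abs_nonneg (c 0))
            nlinarith
    have hcos : 1 / 4 ≤ Real.cos w.im := by
      have h1 := Real.one_sub_sq_div_two_le_cos (x := w.im)
      have h2 : w.im ^ 2 ≤ 1 := by rw [← sq_abs]; nlinarith [abs_nonneg w.im]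
      linarith
    rw [hK, norm_mul, Complex.norm_exp, Complex.norm_real, Real.norm_of_nonneg hr0,
      Complex.re_ofReal_mul, Complex.exp_re]
    have : 0 ≤ r * Real.exp w.re := by positivity
    nlinarith

/-! ### Testing on products -/

/-- The weighted `L^p` norm of a nonnegative function. -/
noncomputable def lwNorm (p α : ℝ) (G : Cn n → ℝ≥0∞) : ℝ≥0∞ :=
  (∫⁻ z, G z ^ p ∂weightedVol n α) ^ (1 / p)

theorem lmixed_mul {p α : Fin 2 → ℝ} (hp : ∀ i, 0 < p i) {A B : Cn n → ℝ≥0∞}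
    (hA : Measurable A) (hB : Measurable B) :
    lmixed p α (fun x => A x.1 * B x.2) = lwNorm (p 0) (α 0) A * lwNorm (p 1) (α 1) B := by
  have h0 := hp 0
  have h1 := hp 1
  simp only [lmixed, lwNorm, ENNReal.mul_rpow_of_nonneg _ _ h0.le]
  have e : ∀ w, (∫⁻ z, A z ^ p 0 * B w ^ p 0 ∂weightedVol n (α 0)) ^ (p 1 / p 0) =
      (∫⁻ z, A z ^ p 0 ∂weightedVol n (α 0)) ^ (p 1 / p 0) * B w ^ p 1 := by
    intro w
    rw [lintegral_mul_const _ (hA.pow_const _),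
      ENNReal.mul_rpow_of_nonneg _ _ (by positivity : 0 ≤ p 1 / p 0), ← ENNReal.rpow_mul (B w),
      mul_div_cancel₀ _ h0.ne']
  simp only [e]
  rw [lintegral_const_mul _ (hB.pow_const _),
    ENNReal.mul_rpow_of_nonneg _ _ (by positivity : 0 ≤ 1 / p 1), ← ENNReal.rpow_mul]
  congr 2
  field_simp

theorem lwNorm_const_mul {p α : ℝ} (hp : 0 < p) (k : ℝ≥0∞) {A : Cn n → ℝ≥0∞}
    (hA : Measurable A) : lwNorm p α (fun z => k * A z) = k * lwNorm p α A := by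
  simp only [lwNorm, ENNReal.mul_rpow_of_nonneg _ _ hp.le]
  rw [lintegral_const_mul _ (hA.pow_const _),
    ENNReal.mul_rpow_of_nonneg _ _ (by positivity : 0 ≤ 1 / p), ← ENNReal.rpow_mul,
    mul_one_div_cancel hp.ne', ENNReal.rpow_one]

/-- Test functions `G` and sets `F` such that `1 - ⟨z, u⟩` is within relative distance `ε` of
`d > 0` for `z ∈ F` and `u` in the support of `G`. -/
structure TestData (ε : ℝ) (F : Set (Cn n)) (G : Cn n → ℝ≥0∞) (d : ℝ) : Prop where
  measurableSet : MeasurableSet F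
  subset_ball : F ⊆ Metric.ball 0 1
  measurable : Measurable G
  ne_top : ∀ u, G u ≠ ∞
  mem_ball : ∀ u, G u ≠ 0 → u ∈ Metric.ball (0 : Cn n) 1
  pos : 0 < d
  close : ∀ z ∈ F, ∀ u, G u ≠ 0 → ‖(1 - inner ℂ u z) / d - 1‖ ≤ ε

/-- A lower bound, up to constants, for the norm of the image of a test function. -/
noncomputable def testValue (a b c q β : ℝ) (F : Set (Cn n)) (G : Cn n → ℝ≥0∞) (d : ℝ) : ℝ≥0∞ :=
  ENNReal.ofReal (d ^ (-c)) * (∫⁻ u, wt b u * G u ∂normVol n) * lwNorm q β (F.indicator (wt a))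

theorem le_enorm_integral_of_le_re {X : Type*} [MeasurableSpace X] {μ : Measure X} {f : X → ℂ}
    (hf : Integrable f μ) (h : ∀ᵐ x ∂μ, ‖f x‖ / 4 ≤ (f x).re) :
    ENNReal.ofReal (1 / 4) * ∫⁻ x, ‖f x‖ₑ ∂μ ≤ ‖∫ x, f x ∂μ‖ₑ := by
  rw [← ofReal_integral_norm_eq_lintegral_enorm hf, ← ENNReal.ofReal_mul (by norm_num),
    ← ofReal_norm]
  refine ENNReal.ofReal_le_ofReal ?_
  calc 1 / 4 * ∫ x, ‖f x‖ ∂μ = ∫ x, ‖f x‖ / 4 ∂μ := by rw [integral_div]; ring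
    _ ≤ ∫ x, (f x).re ∂μ := integral_mono_ae (hf.norm.div_const 4) hf.re h
    _ = (∫ x, f x ∂μ).re := integral_re hf
    _ ≤ _ := Complex.re_le_norm _

/-- On F₀ × F₁ the integrand does not cancel, and the kernel powers are at least constant multiples
of d₀^(-c₁) and d₁^(-c₂). The image is thus bounded below by a product of functions of z and of w,
and mixed norms of products factor. -/
theorem exists_testValue_mul_le {a b c p q α β : Fin 2 → ℝ} (hp : ∀ i, 0 < p i)
    (hq : ∀ i, 0 < q i) {K : Cn n × Cn n → Cn n × Cn n → ℂ} (hK : IsNearlyPositiveKernel b c K)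
    (hbdd : IsBoundedOp a K p α q β) :
    ∃ ε > 0, ε ≤ 1 / 2 ∧ ∃ C : ℝ≥0∞, C ≠ ∞ ∧
      ∀ (F₀ : Set (Cn n)) (G₀ : Cn n → ℝ≥0∞) (d₀ : ℝ) (F₁ : Set (Cn n)) (G₁ : Cn n → ℝ≥0∞) (d₁ : ℝ),
      TestData ε F₀ G₀ d₀ → TestData ε F₁ G₁ d₁ →
      lwNorm (p 0) (α 0) G₀ < ∞ → lwNorm (p 1) (α 1) G₁ < ∞ →
      testValue (a 0) (b 0) (c 0) (q 0) (β 0) F₀ G₀ d₀ *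
        testValue (a 1) (b 1) (c 1) (q 1) (β 1) F₁ G₁ d₁ ≤
        C * (lwNorm (p 0) (α 0) G₀ * lwNorm (p 1) (α 1) G₁) := by
  obtain ⟨ε, hε, hre⟩ := hK.le_re
  obtain ⟨C, hC⟩ := hbdd
  -- The factor 1/4 is lost by passing to the real part, and one factor 2^(-|c|) in each coordinate
  -- by `kerPow_ge`.
  set κ : ℝ := 1 / 4 * (2 ^ (-|-c 0|) * 2 ^ (-|-c 1|)) with hκ
  have hκ0 : 0 < κ := by positivity
  refine ⟨min ε (1 / 2), by positivity, min_le_right _ _, ENNReal.ofReal κ⁻¹ * C,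
    ENNReal.mul_ne_top ENNReal.ofReal_ne_top ENNReal.coe_ne_top, ?_⟩
  intro F₀ G₀ d₀ F₁ G₁ d₁ h₀ h₁ hn₀ hn₁
  set f : Cn n × Cn n → ℂ := fun y => ((G₀ y.1 * G₁ y.2).toReal : ℂ) with hf
  have hGtop : ∀ y : Cn n × Cn n, G₀ y.1 * G₁ y.2 ≠ ∞ := fun y =>
    ENNReal.mul_ne_top (h₀.ne_top _) (h₁.ne_top _)
  have hfe : ∀ y, ‖f y‖ₑ = G₀ y.1 * G₁ y.2 := by
    intro y
    rw [hf, ← ofReal_norm, Complex.norm_real, Real.norm_of_nonneg ENNReal.toReal_nonneg,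
      ENNReal.ofReal_toReal (hGtop y)]
  have hfm : Measurable f := Complex.measurable_ofReal.comp
    ((h₀.measurable.comp measurable_fst).mul (h₁.measurable.comp measurable_snd)).ennreal_toReal
  have hfn : mixedNorm p α f = lwNorm (p 0) (α 0) G₀ * lwNorm (p 1) (α 1) G₁ := by
    rw [mixedNorm_eq_lmixed]
    simp only [hfe]
    exact lmixed_mul hp h₀.measurable h₁.measurable
  obtain ⟨hint, -, hle⟩ := hC f ⟨hfm.aestronglyMeasurable, hfn ▸ ENNReal.mul_lt_top hn₀ hn₁⟩
  set I₀ := ∫⁻ u, wt (b 0) u * G₀ u ∂normVol n with hI₀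
  set I₁ := ∫⁻ u, wt (b 1) u * G₁ u ∂normVol n with hI₁
  set k : ℝ≥0∞ := ENNReal.ofReal κ * (ENNReal.ofReal (d₀ ^ (-c 0)) * I₀ *
    (ENNReal.ofReal (d₁ ^ (-c 1)) * I₁)) with hk
  have hlow : ∀ᵐ x ∂(normVol n).prod (normVol n),
      (k * F₀.indicator (wt (a 0)) x.1) * F₁.indicator (wt (a 1)) x.2 ≤
        ‖integralOp a K f x‖ₑ := by
    filter_upwards [hint] with x hx
    by_cases hx1 : x.1 ∈ F₀
    swap
    · simp [Set.indicator_of_notMem hx1]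
    by_cases hx2 : x.2 ∈ F₁
    swap
    · simp [Set.indicator_of_notMem hx2]
    have hb1 := h₀.subset_ball hx1
    have hb2 := h₁.subset_ball hx2
    rw [Set.indicator_of_mem hx1, Set.indicator_of_mem hx2, integralOp, enorm_mul,
      enorm_one_sub_sq_rpow_mul hb1 hb2]
    have hpt : ∀ᵐ y ∂(normVol n).prod (normVol n), ‖K x y * f y‖ / 4 ≤ (K x y * f y).re := by
      refine Filter.Eventually.of_forall fun y => ?_
      by_cases hy : G₀ y.1 * G₁ y.2 = 0
      · have hfy : f y = 0 := by simp only [hf, hy, ENNReal.toReal_zero, Complex.ofReal_zero]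
        simp [hfy]
      have hy0 := left_ne_zero_of_mul hy
      have hy1 := right_ne_zero_of_mul hy
      have h := hre x y hb1 hb2 (h₀.mem_ball _ hy0) (h₁.mem_ball _ hy1) d₀ d₁ h₀.pos h₁.pos
        ((h₀.close _ hx1 _ hy0).trans (min_le_left _ _))
        ((h₁.close _ hx2 _ hy1).trans (min_le_left _ _))
      have ht : 0 ≤ (G₀ y.1 * G₁ y.2).toReal := ENNReal.toReal_nonneg
      rw [hf, norm_mul, Complex.norm_real, Real.norm_of_nonneg ht, mul_comm (K x y),
        Complex.re_ofReal_mul]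
      nlinarith
    have hI := le_enorm_integral_of_le_re hx hpt
    have hsplit : ENNReal.ofReal (2 ^ (-|-c 0|) * 2 ^ (-|-c 1|)) *
        (ENNReal.ofReal (d₀ ^ (-c 0)) * I₀ * (ENNReal.ofReal (d₁ ^ (-c 1)) * I₁)) ≤
        ∫⁻ y, ‖K x y * f y‖ₑ ∂(normVol n).prod (normVol n) := by
      set m₀ : ℝ≥0∞ := ENNReal.ofReal (2 ^ (-|-c 0|)) * ENNReal.ofReal (d₀ ^ (-c 0)) with hm₀
      set m₁ : ℝ≥0∞ := ENNReal.ofReal (2 ^ (-|-c 1|)) * ENNReal.ofReal (d₁ ^ (-c 1)) with hm₁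
      have hmA : Measurable fun u => wt (b 0) u * G₀ u := (measurable_wt _).mul h₀.measurable
      have hmB : Measurable fun u => wt (b 1) u * G₁ u := (measurable_wt _).mul h₁.measurable
      calc _ = (m₀ * I₀) * (m₁ * I₁) := by
            rw [ENNReal.ofReal_mul (by positivity)]; ring
        _ = ∫⁻ y, (m₀ * (wt (b 0) y.1 * G₀ y.1)) * (m₁ * (wt (b 1) y.2 * G₁ y.2))
              ∂(normVol n).prod (normVol n) := by
            rw [hI₀, hI₁, ← lintegral_const_mul _ hmA, ← lintegral_const_mul _ hmB]
            exact (lintegral_prod_mul (hmA.const_mul _).aemeasurable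
              (hmB.const_mul _).aemeasurable).symm
        _ ≤ _ := by
            refine lintegral_mono fun y => ?_
            by_cases hy : G₀ y.1 * G₁ y.2 = 0
            · rcases mul_eq_zero.1 hy with h | h <;> simp [h]
            have hy0 := left_ne_zero_of_mul hy
            have hy1 := right_ne_zero_of_mul hy
            rw [enorm_mul, hfe,
              hK.enorm_eq x y hb1 hb2 (h₀.mem_ball _ hy0) (h₁.mem_ball _ hy1)]
            have g0 : m₀ ≤ kerPow (-c 0) x.1 y.1 := kerPow_ge h₀.pos
              ((h₀.close _ hx1 _ hy0).trans (min_le_right _ _)) _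
            have g1 : m₁ ≤ kerPow (-c 1) x.2 y.2 := kerPow_ge h₁.pos
              ((h₁.close _ hx2 _ hy1).trans (min_le_right _ _)) _
            calc _ ≤ (kerPow (-c 0) x.1 y.1 * (wt (b 0) y.1 * G₀ y.1)) *
                  (kerPow (-c 1) x.2 y.2 * (wt (b 1) y.2 * G₁ y.2)) := by gcongr
              _ = _ := by ring
    calc k * wt (a 0) x.1 * wt (a 1) x.2 = wt (a 0) x.1 * wt (a 1) x.2 *
          (ENNReal.ofReal (1 / 4) * (ENNReal.ofReal (2 ^ (-|-c 0|) * 2 ^ (-|-c 1|)) *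
          (ENNReal.ofReal (d₀ ^ (-c 0)) * I₀ * (ENNReal.ofReal (d₁ ^ (-c 1)) * I₁)))) := by
          rw [hk, hκ, ENNReal.ofReal_mul (by norm_num : (0 : ℝ) ≤ 1 / 4)]; ring
      _ ≤ _ := by
          gcongr
          exact (mul_le_mul_right hsplit _).trans hI
  have hmain := (lmixed_mono_ae (α := β) hq hlow).trans hle
  have hA : Measurable (F₀.indicator (wt (a 0))) := (measurable_wt _).indicator h₀.measurableSet
  have hB : Measurable (F₁.indicator (wt (a 1))) := (measurable_wt _).indicator h₁.measurableSet
  rw [lmixed_mul hq (hA.const_mul k) hB, lwNorm_const_mul (hq 0) k hA, hfn] at hmain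
  have hκκ : ENNReal.ofReal κ⁻¹ * ENNReal.ofReal κ = 1 := by
    rw [← ENNReal.ofReal_mul (by positivity), inv_mul_cancel₀ hκ0.ne', ENNReal.ofReal_one]
  calc _ = (ENNReal.ofReal κ⁻¹ * ENNReal.ofReal κ) *
        (testValue (a 0) (b 0) (c 0) (q 0) (β 0) F₀ G₀ d₀ *
        testValue (a 1) (b 1) (c 1) (q 1) (β 1) F₁ G₁ d₁) := by rw [hκκ, one_mul]
    _ = ENNReal.ofReal κ⁻¹ * (k * lwNorm (q 0) (β 0) (F₀.indicator (wt (a 0))) *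
          lwNorm (q 1) (β 1) (F₁.indicator (wt (a 1)))) := by
        rw [hk, testValue, testValue]; ring
    _ ≤ ENNReal.ofReal κ⁻¹ * (C * (lwNorm (p 0) (α 0) G₀ * lwNorm (p 1) (α 1) G₁)) :=
        mul_le_mul_right hmain _
    _ = _ := by ring

/-! ### Test data at the origin and reduction to one coordinate -/

theorem normVol_ball_ne_zero {ρ : ℝ} (hρ : 0 < ρ) (hρ1 : ρ ≤ 1) :
    normVol n (Metric.ball 0 ρ) ≠ 0 := by
  rw [normVol, Measure.smul_apply, Measure.restrict_apply measurableSet_ball,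
    Set.inter_eq_left.2 (Metric.ball_subset_ball hρ1), smul_eq_mul]
  exact mul_ne_zero volume_ball_inv_ne_zero (Metric.measure_ball_pos volume _ hρ).ne'

theorem lintegral_normVol_ne_zero {ρ : ℝ} (hρ : 0 < ρ) (hρ1 : ρ ≤ 1) {H : Cn n → ℝ≥0∞}
    (hH : Measurable H) (h : ∀ u ∈ Metric.ball (0 : Cn n) ρ, H u ≠ 0) :
    ∫⁻ u, H u ∂normVol n ≠ 0 := by
  rw [Ne, lintegral_eq_zero_iff hH]
  intro h0
  refine normVol_ball_ne_zero (n := n) hρ hρ1 (measure_mono_null (fun u hu => ?_) h0)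
  exact h u hu

theorem lwNorm_ne_zero {q β ρ : ℝ} (hq : 0 < q) (hβ : -1 < β) (hρ : 0 < ρ) (hρ1 : ρ ≤ 1)
    {H : Cn n → ℝ≥0∞} (hH : Measurable H) (h : ∀ u ∈ Metric.ball (0 : Cn n) ρ, H u ≠ 0) :
    lwNorm q β H ≠ 0 := by
  have hi : ∫⁻ z, wt β z * H z ^ q ∂normVol n ≠ 0 := by
    refine lintegral_normVol_ne_zero hρ hρ1 ((measurable_wt _).mul (hH.pow_const _)) fun u hu => ?_
    refine mul_ne_zero (wt_ne_zero (Metric.ball_subset_ball hρ1 hu) _) ?_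
    simp [h u hu, hq.le]
  have hW : ENNReal.ofReal (weightConst n β) ≠ 0 := by simpa using weightConst_pos hβ
  rw [lwNorm, lintegral_weightedVol hβ (hH.pow_const q)]
  simp only [ne_eq, ENNReal.rpow_eq_zero_iff, not_or, not_and, not_lt]
  refine ⟨fun h => absurd h (mul_ne_zero hW hi), fun _ => by positivity⟩

theorem lwNorm_indicator_one_lt_top (hn : 1 ≤ n) {p α : ℝ} (hp : 0 < p) (hα : -1 < α)
    (E : Set (Cn n)) : lwNorm p α (E.indicator 1) < ∞ := by
  have := isFiniteMeasure_weightedVol hn hα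
  refine ENNReal.rpow_lt_top_of_nonneg (by positivity) (lt_of_le_of_lt ?_
    (measure_lt_top (weightedVol n α) Set.univ)).ne
  rw [← lintegral_one]
  refine lintegral_mono fun z => ?_
  calc E.indicator 1 z ^ p ≤ (1 : ℝ≥0∞) ^ p :=
        ENNReal.rpow_le_rpow (Set.indicator_le_self' (by simp) z) hp.le
    _ = 1 := ENNReal.one_rpow p

theorem norm_one_sub_inner_div_one_sub_one_le {z u : Cn n} {ε : ℝ}
    (h : ‖z‖ * ‖u‖ ≤ ε) : ‖(1 - inner ℂ u z) / ((1 : ℝ) : ℂ) - 1‖ ≤ ε := by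
  have : (1 - inner ℂ u z) / ((1 : ℝ) : ℂ) - 1 = -inner ℂ u z := by simp
  rw [this, norm_neg]
  exact ((norm_inner_le_norm _ _).trans_eq (mul_comm _ _)).trans h

/-- If one of the two points is near 0, then ⟨z,u⟩ is small and d = 1 works, wherever in the ball
the other one is. -/
theorem testData_ball {ε ρ σ : ℝ} (hρ : ρ ≤ 1) (hσ : σ ≤ 1) (hσ0 : 0 ≤ σ) (h : σ * ρ ≤ ε)
    {G : Cn n → ℝ≥0∞} (hG : Measurable G) (hGtop : ∀ u, G u ≠ ∞) :
    TestData ε (Metric.ball (0 : Cn n) σ) ((Metric.ball 0 ρ).indicator G) 1 where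
  measurableSet := measurableSet_ball
  subset_ball := Metric.ball_subset_ball hσ
  measurable := hG.indicator measurableSet_ball
  ne_top u := by
    by_cases hu : u ∈ Metric.ball (0 : Cn n) ρ
    · rw [Set.indicator_of_mem hu]; exact hGtop u
    · rw [Set.indicator_of_notMem hu]; simp
  mem_ball u hu := Metric.ball_subset_ball hρ (Set.mem_of_indicator_ne_zero hu)
  pos := one_pos
  close z hz u hu := by
    have hu' : u ∈ Metric.ball (0 : Cn n) ρ := Set.mem_of_indicator_ne_zero hu
    refine norm_one_sub_inner_div_one_sub_one_le (le_trans ?_ h)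
    rw [mem_ball_zero_iff] at hz hu'
    gcongr

theorem exists_testData_testValue_ne_zero (hn : 1 ≤ n) {ε : ℝ} (hε : 0 < ε)
    {a b c p q α β : ℝ} (hp : 0 < p) (hq : 0 < q) (hα : -1 < α) (hβ : -1 < β) :
    ∃ (F : Set (Cn n)) (G : Cn n → ℝ≥0∞) (d : ℝ), TestData ε F G d ∧
      testValue a b c q β F G d ≠ 0 ∧ lwNorm p α G < ∞ := by
  have hρ : 0 < min ε 1 := by positivity
  have hρ1 : min ε 1 ≤ 1 := min_le_right _ _
  refine ⟨Metric.ball 0 (min ε 1), (Metric.ball 0 (min ε 1)).indicator 1, 1,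
    testData_ball hρ1 hρ1 hρ.le ?_ measurable_one (by simp), ?_,
    lwNorm_indicator_one_lt_top hn hp hα _⟩
  · calc min ε 1 * min ε 1 ≤ ε * 1 := by gcongr; exact min_le_left _ _
      _ = ε := mul_one ε
  · refine mul_ne_zero (mul_ne_zero (by simp) ?_) ?_
    · refine lintegral_normVol_ne_zero hρ hρ1
        ((measurable_wt _).mul (measurable_one.indicator measurableSet_ball)) fun u hu => ?_
      rw [Set.indicator_of_mem hu]
      simpa using wt_ne_zero (Metric.ball_subset_ball hρ1 hu) b
    · refine lwNorm_ne_zero hq hβ hρ hρ1 ((measurable_wt _).indicator measurableSet_ball)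
        fun u hu => ?_
      rw [Set.indicator_of_mem hu]
      exact wt_ne_zero (Metric.ball_subset_ball hρ1 hu) a

/-- The estimate on test functions in one coordinate which is implied by boundedness. -/
def HasTestBound (n : ℕ) (a b c p q α β : ℝ) : Prop :=
  ∃ ε > 0, ε ≤ 1 / 2 ∧ ∃ C : ℝ≥0∞, C ≠ ∞ ∧ ∀ (F : Set (Cn n)) (G : Cn n → ℝ≥0∞) (d : ℝ),
    TestData ε F G d → lwNorm p α G < ∞ → testValue a b c q β F G d ≤ C * lwNorm p α G

theorem le_mul_inv_mul_of_mul_le_mul {t s C x y : ℝ≥0∞} (hs : s ≠ 0) (hC : C ≠ ∞) (hx : x ≠ ∞)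
    (hy : y ≠ ∞) (h : t * s ≤ C * (x * y)) : t ≤ C * y * s⁻¹ * x := by
  by_cases ht : t = 0
  · rw [ht]; exact zero_le
  have hst : s ≠ ∞ := by
    rintro rfl
    rw [ENNReal.mul_top ht, top_le_iff] at h
    exact ENNReal.mul_ne_top hC (ENNReal.mul_ne_top hx hy) h
  calc t = t * s * s⁻¹ := by rw [mul_assoc, ENNReal.mul_inv_cancel hs hst, mul_one]
    _ ≤ C * (x * y) * s⁻¹ := by gcongr
    _ = _ := by ring

/-- The other coordinate is frozen at data with nonzero test value and finite norm, and the product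
inequality is divided by that value. -/
theorem hasTestBound_of_isBoundedOp (hn : 1 ≤ n) {a b c p q α β : Fin 2 → ℝ} (hp : ∀ i, 0 < p i)
    (hq : ∀ i, 0 < q i) (hα : ∀ i, -1 < α i) (hβ : ∀ i, -1 < β i)
    {K : Cn n × Cn n → Cn n × Cn n → ℂ} (hK : IsNearlyPositiveKernel b c K)
    (hbdd : IsBoundedOp a K p α q β) (i : Fin 2) :
    HasTestBound n (a i) (b i) (c i) (p i) (q i) (α i) (β i) := by
  obtain ⟨ε, hε, hε2, C, hC, h⟩ := exists_testValue_mul_le hp hq hK hbdd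
  refine ⟨ε, hε, hε2, ?_⟩
  fin_cases i
  · obtain ⟨F₁, G₁, d₁, hd, hv, hl⟩ := exists_testData_testValue_ne_zero hn hε
      (a := a 1) (b := b 1) (c := c 1) (hp 1) (hq 1) (hα 1) (hβ 1)
    refine ⟨C * lwNorm (p 1) (α 1) G₁ * (testValue (a 1) (b 1) (c 1) (q 1) (β 1) F₁ G₁ d₁)⁻¹,
      ENNReal.mul_ne_top (ENNReal.mul_ne_top hC hl.ne) (ENNReal.inv_ne_top.2 hv),
      fun F G d hF hG => ?_⟩
    exact le_mul_inv_mul_of_mul_le_mul hv hC hG.ne hl.ne (h F G d F₁ G₁ d₁ hF hd hG hl)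
  · obtain ⟨F₀, G₀, d₀, hd, hv, hl⟩ := exists_testData_testValue_ne_zero hn hε
      (a := a 0) (b := b 0) (c := c 0) (hp 0) (hq 0) (hα 0) (hβ 0)
    refine ⟨C * lwNorm (p 0) (α 0) G₀ * (testValue (a 0) (b 0) (c 0) (q 0) (β 0) F₀ G₀ d₀)⁻¹,
      ENNReal.mul_ne_top (ENNReal.mul_ne_top hC hl.ne) (ENNReal.inv_ne_top.2 hv),
      fun F G d hF hG => ?_⟩
    have := h F₀ G₀ d₀ F G d hd hF hl hG
    rw [mul_comm, mul_comm (lwNorm (p 0) (α 0) G₀)] at this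
    exact le_mul_inv_mul_of_mul_le_mul hv hC hG.ne hl.ne this

/-! ### Necessity of the two weight conditions -/

/-- On (1/2, 1) the function is bounded below by a constant multiple of 1/(1 - y), which is not
integrable at 1. -/
theorem not_integrableOn_radial (N : ℕ) :
    ¬ IntegrableOn (fun y : ℝ => y ^ N * (1 - y ^ 2) ^ (-1 : ℝ)) (Set.Ioo 0 1) := by
  intro h
  have h1 : IntegrableOn (fun y : ℝ => y ^ N * (1 - y ^ 2) ^ (-1 : ℝ)) (Set.Ioo (1 / 2) 1) :=
    h.mono_set (Set.Ioo_subset_Ioo_left (by norm_num))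
  have h2 : IntegrableOn (fun y : ℝ => (y - 1)⁻¹) (Set.Ioo (1 / 2) 1) := by
    refine Integrable.mono' (h1.const_mul (2 ^ N * 2)) (by fun_prop) ?_
    filter_upwards [ae_restrict_mem measurableSet_Ioo] with y hy
    have hy1 : 0 < 1 - y := by linarith [hy.2]
    have hy0 : 0 < y := by linarith [hy.1]
    have e1 : ‖(y - 1)⁻¹‖ = (1 - y)⁻¹ := by
      rw [norm_inv, Real.norm_eq_abs, abs_sub_comm, abs_of_pos hy1]
    have e2 : 1 - y ^ 2 = (1 + y) * (1 - y) := by ring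
    have e3 : 1 ≤ (2 * y) ^ N := one_le_pow₀ (by linarith [hy.1])
    have e4 : (2 : ℝ)⁻¹ ≤ (1 + y)⁻¹ := inv_anti₀ (by linarith) (by linarith [hy.2])
    rw [e1, e2, Real.rpow_neg_one, mul_inv]
    calc (1 - y)⁻¹ = 1 * (2 * 2⁻¹) * (1 - y)⁻¹ := by norm_num
      _ ≤ (2 * y) ^ N * (2 * (1 + y)⁻¹) * (1 - y)⁻¹ := by gcongr
      _ = _ := by rw [mul_pow]; ring
  have h3 : IntervalIntegrable (fun y : ℝ => (y - 1)⁻¹) volume (1 / 2) 1 := by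
    rw [intervalIntegrable_iff_integrableOn_Ioo_of_le (by norm_num)]
    exact h2
  rw [intervalIntegrable_sub_inv_iff] at h3
  rcases h3 with h3 | h3
  · norm_num at h3
  · exact h3 Set.right_mem_uIcc

theorem wt_le_wt {z : Cn n} (hz : z ∈ Metric.ball (0 : Cn n) 1) {s t : ℝ} (h : s ≤ t) :
    wt t z ≤ wt s z :=
  ENNReal.ofReal_le_ofReal (Real.rpow_le_rpow_of_exponent_ge (one_sub_sq_pos hz)
    (by nlinarith [sq_nonneg ‖z‖]) h)

theorem lintegral_wt_eq_top (hn : 1 ≤ n) {s : ℝ} (hs : s ≤ -1) :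
    ∫⁻ z : Cn n, wt s z ∂normVol n = ∞ := by
  have : Nonempty (Fin n) := ⟨⟨0, hn⟩⟩
  by_contra hne
  have h1 : ∫⁻ z : Cn n, wt (-1) z ∂normVol n < ∞ := by
    refine lt_of_le_of_lt (lintegral_mono_ae ?_) (lt_top_iff_ne_top.2 hne)
    filter_upwards [ae_mem_ball] with z hz
    exact wt_le_wt hz hs
  rw [lintegral_normVol] at h1
  have h2 : ∫⁻ z in Metric.ball (0 : Cn n) 1, wt (-1) z < ∞ := by
    refine lt_of_not_ge fun h => ?_
    rw [top_le_iff.1 h, ENNReal.mul_top volume_ball_inv_ne_zero] at h1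
    exact lt_irrefl _ h1
  have h3 : IntegrableOn (fun z : Cn n => (1 - ‖z‖ ^ 2) ^ (-1 : ℝ)) (Metric.ball 0 1) := by
    have hm : Measurable fun z : Cn n => (1 - ‖z‖ ^ 2) ^ (-1 : ℝ) := by fun_prop
    refine ⟨hm.aestronglyMeasurable, ?_⟩
    rw [hasFiniteIntegral_iff_ofReal]
    · exact h2
    · filter_upwards [ae_restrict_mem measurableSet_ball] with z hz
      exact Real.rpow_nonneg (one_sub_sq_pos hz).le _
  rw [integrableOn_fun_norm_addHaar volume (f := fun y : ℝ => (1 - y ^ 2) ^ (-1 : ℝ))] at h3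
  exact not_integrableOn_radial _ h3

/-- The outer weight must be integrable. -/
theorem HasTestBound.outer_weight (hn : 1 ≤ n) {a b c p q α β : ℝ} (hp : 0 < p) (hq : 0 < q)
    (hα : -1 < α) (hβ : -1 < β) (h : HasTestBound n a b c p q α β) : -(q * a) < β + 1 := by
  obtain ⟨ε, hε, hε2, C, hC, h⟩ := h
  by_contra hcon
  have hε1 : ε ≤ 1 := by linarith
  have hl := lwNorm_indicator_one_lt_top hn hp hα (Metric.ball (0 : Cn n) ε)
  -- G is the indicator of the ε-ball and F the whole unit ball, so the test value contains the full
  -- norm of (1 - |z|²)^a. That norm is infinite if βq-integrability fails, that is, if β + qa ≤ -1.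
  have hb := h _ _ 1 (testData_ball (n := n) (ε := ε) hε1 le_rfl zero_le_one (by linarith)
    measurable_one (by simp)) hl
  have hI : ∫⁻ u, wt b u * (Metric.ball (0 : Cn n) ε).indicator 1 u ∂normVol n ≠ 0 := by
    refine lintegral_normVol_ne_zero hε hε1
      ((measurable_wt _).mul (measurable_one.indicator measurableSet_ball)) fun u hu => ?_
    rw [Set.indicator_of_mem hu]
    simpa using wt_ne_zero (Metric.ball_subset_ball hε1 hu) b
  have htop : lwNorm q β ((Metric.ball (0 : Cn n) 1).indicator (wt a)) = ∞ := by
    have hm : Measurable ((Metric.ball (0 : Cn n) 1).indicator (wt a)) :=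
      (measurable_wt _).indicator measurableSet_ball
    have hW : ENNReal.ofReal (weightConst n β) ≠ 0 := by simpa using weightConst_pos hβ
    have e : ∫⁻ z, wt β z * (Metric.ball (0 : Cn n) 1).indicator (wt a) z ^ q ∂normVol n = ∞ := by
      rw [← lintegral_wt_eq_top hn (s := β + a * q) (by linarith)]
      refine lintegral_congr_ae ?_
      filter_upwards [ae_mem_ball] with z hz
      rw [Set.indicator_of_mem hz, wt_rpow hz, wt_mul_wt hz]
    rw [lwNorm, lintegral_weightedVol hβ (hm.pow_const q), e, ENNReal.mul_top hW,
      ENNReal.top_rpow_of_pos (by positivity)]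
  rw [testValue, htop, ENNReal.mul_top (mul_ne_zero (by simp) hI), top_le_iff] at hb
  exact ENNReal.mul_ne_top hC hl.ne hb

/-- The inner weight must lie in the dual space. -/
theorem HasTestBound.inner_weight (hn : 1 ≤ n) {a b c p q α β : ℝ} (hp : 1 < p) (hq : 0 < q)
    (hα : -1 < α) (hβ : -1 < β) (h : HasTestBound n a b c p q α β) : α + 1 < p * (b + 1) := by
  obtain ⟨ε, hε, hε2, C, hC, h⟩ := h
  by_contra hcon
  have hp0 : 0 < p := by linarith
  have hε1 : ε ≤ 1 := by linarith
  set V : ℝ≥0∞ := ENNReal.ofReal (weightConst n α) with hV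
  set ν := lwNorm q β ((Metric.ball (0 : Cn n) ε).indicator (wt a)) with hν
  have hν0 : ν ≠ 0 := lwNorm_ne_zero hq hβ hε hε1
    ((measurable_wt _).indicator measurableSet_ball) fun u hu => by
      rw [Set.indicator_of_mem hu]
      exact wt_ne_zero (Metric.ball_subset_ball hε1 hu) a
  -- The test function is (1 - |u|²)^(t-b-1), whose pairing with (1 - |u|²)^b is J(t). If the
  -- condition failed, its norm would be at most a constant times J(t)^(1/p), so J(t)^(1-1/p) would
  -- stay bounded as t → 0.
  set J : ℝ → ℝ≥0∞ := fun t => ∫⁻ u : Cn n, wt (t - 1) u ∂normVol n with hJ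
  set D : ℝ≥0∞ := C * V ^ (1 / p) * ν⁻¹ with hD
  have hDtop : D ≠ ∞ := ENNReal.mul_ne_top (ENNReal.mul_ne_top hC
    (ENNReal.rpow_ne_top_of_nonneg (by positivity) ENNReal.ofReal_ne_top))
    (ENNReal.inv_ne_top.2 hν0)
  have hpe : 0 < 1 - 1 / p := by
    rw [sub_pos, div_lt_one hp0]; exact hp
  have hbound : ∀ t : ℝ, 0 < t → J t ≤ D ^ (1 / (1 - 1 / p)) := by
    intro t ht
    have hJtop : J t ≠ ∞ := lintegral_wt_ne_top hn (by linarith)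
    have hJ0 : J t ≠ 0 := lintegral_normVol_ne_zero one_pos le_rfl (measurable_wt _)
      fun u hu => wt_ne_zero hu _
    have hGm : Measurable ((Metric.ball (0 : Cn n) 1).indicator (wt (t - b - 1))) :=
      (measurable_wt _).indicator measurableSet_ball
    have hG : lwNorm p α ((Metric.ball (0 : Cn n) 1).indicator (wt (t - b - 1))) ≤
        V ^ (1 / p) * J t ^ (1 / p) := by
      rw [lwNorm, lintegral_weightedVol hα (hGm.pow_const p),
        ENNReal.mul_rpow_of_nonneg _ _ (by positivity)]
      gcongr
      refine lintegral_mono_ae ?_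
      filter_upwards [ae_mem_ball] with z hz
      rw [Set.indicator_of_mem hz, wt_rpow hz, wt_mul_wt hz]
      refine wt_le_wt hz ?_
      nlinarith
    have hb := h _ _ 1 (testData_ball (n := n) (ε := ε) le_rfl hε1 hε.le (by linarith)
      (measurable_wt (t - b - 1)) (fun _ => wt_ne_top)) (hG.trans_lt (ENNReal.mul_lt_top
        (ENNReal.rpow_lt_top_of_nonneg (by positivity) ENNReal.ofReal_ne_top)
        (ENNReal.rpow_lt_top_of_nonneg (by positivity) hJtop)))
    have hI : ∫⁻ u, wt b u * (Metric.ball (0 : Cn n) 1).indicator (wt (t - b - 1)) u ∂normVol n =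
        J t := by
      refine lintegral_congr_ae ?_
      filter_upwards [ae_mem_ball] with z hz
      rw [Set.indicator_of_mem hz, wt_mul_wt hz]
      congr 1; ring
    rw [testValue, hI, Real.one_rpow, ENNReal.ofReal_one, one_mul] at hb
    have hb2 : J t * ν ≤ C * (J t ^ (1 / p) * V ^ (1 / p)) := by
      refine hb.trans ?_
      rw [mul_comm (J t ^ (1 / p))]
      exact mul_le_mul_right hG _
    have hb3 := le_mul_inv_mul_of_mul_le_mul hν0 hC
      (ENNReal.rpow_ne_top_of_nonneg (by positivity) hJtop)
      (ENNReal.rpow_ne_top_of_nonneg (by positivity) ENNReal.ofReal_ne_top) hb2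
    have hsplit : J t = J t ^ (1 - 1 / p) * J t ^ (1 / p) := by
      rw [← ENNReal.rpow_add _ _ hJ0 hJtop, sub_add_cancel, ENNReal.rpow_one]
    have hb4 : J t ^ (1 - 1 / p) ≤ D := by
      refine (ENNReal.mul_le_mul_iff_left (c := J t ^ (1 / p)) ?_ ?_).1 ?_
      · exact (ENNReal.rpow_pos (pos_iff_ne_zero.2 hJ0) hJtop).ne'
      · exact ENNReal.rpow_ne_top_of_nonneg (by positivity) hJtop
      · rw [← hsplit]; exact hb3
    calc J t = (J t ^ (1 - 1 / p)) ^ (1 / (1 - 1 / p)) := by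
          rw [← ENNReal.rpow_mul, mul_one_div_cancel hpe.ne', ENNReal.rpow_one]
      _ ≤ _ := ENNReal.rpow_le_rpow hb4 (by positivity)
  -- Fatou as t = 1/(k+1) → 0 would make (1 - |u|²)^(-1) integrable.
  have hfatou : ∫⁻ u : Cn n, wt (-1) u ∂normVol n ≤ D ^ (1 / (1 - 1 / p)) := by
    calc ∫⁻ u : Cn n, wt (-1) u ∂normVol n
        = ∫⁻ u : Cn n, Filter.liminf (fun k : ℕ => wt (1 / ((k : ℝ) + 1) - 1) u) Filter.atTop
            ∂normVol n := by
          refine lintegral_congr_ae ?_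
          filter_upwards [ae_mem_ball] with z hz
          have hz0 := one_sub_sq_pos hz
          have h1 : Filter.Tendsto (fun k : ℕ => (1 / ((k : ℝ) + 1) - 1)) Filter.atTop
              (nhds (0 - 1)) := tendsto_one_div_add_atTop_nhds_zero_nat.sub_const 1
          have h2 := ENNReal.tendsto_ofReal
            (((Real.continuousAt_const_rpow hz0.ne').tendsto).comp h1)
          rw [zero_sub] at h2
          exact h2.liminf_eq.symm
      _ ≤ Filter.liminf (fun k : ℕ => J (1 / ((k : ℝ) + 1))) Filter.atTop :=
          lintegral_liminf_le fun k => measurable_wt _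
      _ ≤ D ^ (1 / (1 - 1 / p)) :=
          Filter.liminf_le_of_le (by isBoundedDefault) fun x hx => by
            obtain ⟨k, hk⟩ := hx.exists
            exact hk.trans (hbound _ (by positivity))
  rw [lintegral_wt_eq_top hn le_rfl, top_le_iff] at hfatou
  exact ENNReal.rpow_ne_top_of_nonneg (by positivity) hDtop hfatou

/-! ### Necessity of the exponent condition -/

/-- On the box of size `δ` around `(1 - δ) e`, the quantity `1 - ⟨z, u⟩` is close to `2δ`. -/
theorem norm_one_sub_inner_sub_le_of_mem_box (i₀ : Fin n) {η δ : ℝ} (hη : 0 < η)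
    (hnη : n * η ≤ 1) (hη1 : η ≤ 1) (hδ : 0 < δ) (hδ1 : δ ≤ 1) {z u : Cn n}
    (hz : z ∈ box i₀ ((1 - δ : ℝ) : ℂ) (η * δ) (η * Real.sqrt δ))
    (hu : u ∈ box i₀ ((1 - δ : ℝ) : ℂ) (η * δ) (η * Real.sqrt δ)) :
    ‖1 - inner ℂ u z - (2 * δ : ℝ)‖ ≤ δ * (δ + 4 * η) := by
  set s : ℂ := z i₀ - ((1 - δ : ℝ) : ℂ) with hs
  set t : ℂ := u i₀ - ((1 - δ : ℝ) : ℂ) with ht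
  have hsn : ‖s‖ ≤ η * δ := hz.1.le
  have htn : ‖t‖ ≤ η * δ := hu.1.le
  have hinner : inner ℂ u z = z i₀ * (starRingEnd ℂ) (u i₀) +
      ∑ j ∈ Finset.univ.erase i₀, z j * (starRingEnd ℂ) (u j) := by
    rw [PiLp.inner_apply, ← Finset.add_sum_erase _ _ (Finset.mem_univ i₀)]
    simp
  set T : ℂ := ∑ j ∈ Finset.univ.erase i₀, z j * (starRingEnd ℂ) (u j) with hT
  have hsum : ‖T‖ ≤ η * δ := by
    calc ‖T‖ ≤ ∑ j ∈ Finset.univ.erase i₀, ‖z j * (starRingEnd ℂ) (u j)‖ := norm_sum_le _ _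
      _ ≤ ∑ j ∈ Finset.univ.erase i₀, η ^ 2 * δ := by
          refine Finset.sum_le_sum fun j hj => ?_
          have hj' := Finset.ne_of_mem_erase hj
          rw [norm_mul, Complex.norm_conj]
          calc ‖z j‖ * ‖u j‖ ≤ (η * Real.sqrt δ) * (η * Real.sqrt δ) := by
                gcongr
                · exact (hz.2 j hj').le
                · exact (hu.2 j hj').le
            _ = η ^ 2 * (Real.sqrt δ * Real.sqrt δ) := by ring
            _ = η ^ 2 * δ := by rw [Real.mul_self_sqrt hδ.le]
      _ ≤ ∑ j : Fin n, η ^ 2 * δ :=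
          Finset.sum_le_sum_of_subset_of_nonneg (Finset.subset_univ _) fun _ _ _ => by positivity
      _ = (n * η) * (η * δ) := by simp; ring
      _ ≤ 1 * (η * δ) := by gcongr
      _ = η * δ := one_mul _
  have hz0 : z i₀ = ((1 - δ : ℝ) : ℂ) + s := by rw [hs]; ring
  have hu0 : u i₀ = ((1 - δ : ℝ) : ℂ) + t := by rw [ht]; ring
  -- The centre contributes 1 - (1 - δ)² = 2δ - δ²; the deviations s, t and the off-axis sum T are
  -- each at most ηδ.
  have hexp : 1 - inner ℂ u z - (2 * δ : ℝ) =
      -((δ ^ 2 : ℝ) + ((1 - δ : ℝ) : ℂ) * (s + (starRingEnd ℂ) t) + s * (starRingEnd ℂ) t + T) := by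
    rw [hinner, hz0, hu0, map_add, Complex.conj_ofReal]
    push_cast
    ring
  rw [hexp, norm_neg]
  have h1 : ‖((δ ^ 2 : ℝ) : ℂ)‖ = δ ^ 2 := by
    rw [Complex.norm_real, Real.norm_of_nonneg (by positivity)]
  have h2 : ‖((1 - δ : ℝ) : ℂ) * (s + (starRingEnd ℂ) t)‖ ≤ 1 * (η * δ + η * δ) := by
    rw [norm_mul]
    gcongr
    · rw [Complex.norm_real, Real.norm_of_nonneg (by linarith)]; linarith
    · refine (norm_add_le _ _).trans ?_
      rw [Complex.norm_conj]; gcongr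
  have h3 : ‖s * (starRingEnd ℂ) t‖ ≤ η * δ := by
    rw [norm_mul, Complex.norm_conj]
    calc ‖s‖ * ‖t‖ ≤ (η * δ) * (1 * 1) := by
          gcongr
          exact htn.trans (by gcongr)
      _ = η * δ := by ring
  have h4 := norm_add_le ((δ ^ 2 : ℝ) + ((1 - δ : ℝ) : ℂ) * (s + (starRingEnd ℂ) t) +
    s * (starRingEnd ℂ) t) T
  have h5 := norm_add_le ((δ ^ 2 : ℝ) + ((1 - δ : ℝ) : ℂ) * (s + (starRingEnd ℂ) t))
    (s * (starRingEnd ℂ) t)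
  have h6 := norm_add_le ((δ ^ 2 : ℝ) : ℂ) (((1 - δ : ℝ) : ℂ) * (s + (starRingEnd ℂ) t))
  nlinarith

/-- If e₂ > e₁, dividing by δ^e₁ and letting δ → 0 would force A ≤ 0. -/
theorem le_of_forall_mul_rpow_le {A B e₁ e₂ δ₀ : ℝ} (hA : 0 < A) (hδ₀ : 0 < δ₀)
    (h : ∀ δ : ℝ, 0 < δ → δ ≤ δ₀ → A * δ ^ e₁ ≤ B * δ ^ e₂) : e₂ ≤ e₁ := by
  by_contra! hlt
  have hlim : Filter.Tendsto (fun δ : ℝ => B * δ ^ (e₂ - e₁)) (nhdsWithin 0 (Set.Ioi 0))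
      (nhds (B * 0)) := by
    have h1 : Filter.Tendsto (fun δ : ℝ => δ ^ (e₂ - e₁)) (nhds 0) (nhds 0) := by
      have := (Real.continuousAt_rpow_const (0 : ℝ) (e₂ - e₁) (Or.inr (by linarith))).tendsto
      rwa [Real.zero_rpow (by linarith)] at this
    exact (h1.mono_left nhdsWithin_le_nhds).const_mul B
  rw [mul_zero] at hlim
  have hge : A ≤ 0 := by
    refine ge_of_tendsto hlim ?_
    filter_upwards [Ioc_mem_nhdsGT hδ₀] with δ hδ
    have h1 := h δ hδ.1 hδ.2
    rw [Real.rpow_sub hδ.1, ← mul_div_assoc, le_div_iff₀ (Real.rpow_pos_of_pos hδ.1 _)]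
    exact h1
  linarith

/-- Bounds for the weight where `1 - |u|²` is comparable to `δ`. -/
theorem wt_bounds {u : Cn n} {δ : ℝ} (hδ : 0 < δ) (h₁ : δ ≤ 1 - ‖u‖ ^ 2)
    (h₂ : 1 - ‖u‖ ^ 2 ≤ 3 * δ) (s : ℝ) :
    ENNReal.ofReal (3 ^ (-|s|) * δ ^ s) ≤ wt s u ∧ wt s u ≤ ENNReal.ofReal (3 ^ |s| * δ ^ s) := by
  have hx0 : 0 ≤ 1 - ‖u‖ ^ 2 := hδ.le.trans h₁
  have hy₁ : (3 : ℝ)⁻¹ ≤ (1 - ‖u‖ ^ 2) / δ := by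
    rw [le_div_iff₀ hδ]; linarith
  have hy₂ : (1 - ‖u‖ ^ 2) / δ ≤ 3 := by
    rw [div_le_iff₀ hδ]; linarith
  rw [wt, ← rpow_div_mul hx0 hδ]
  constructor <;> refine ENNReal.ofReal_le_ofReal
    (mul_le_mul_of_nonneg_right ?_ (Real.rpow_nonneg hδ.le _))
  · exact rpow_neg_abs_le_rpow (by norm_num) hy₁ hy₂ s
  · exact rpow_le_rpow_abs (by norm_num) hy₁ hy₂ s

theorem exists_normVol_box (i₀ : Fin n) {η : ℝ} (hη : 0 < η) :
    ∃ k : ℝ, 0 < k ∧ ∀ δ : ℝ, 0 < δ → ∀ c : ℂ,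
      box i₀ c (η * δ) (η * Real.sqrt δ) ⊆ Metric.ball 0 1 →
      normVol n (box i₀ c (η * δ) (η * Real.sqrt δ)) = ENNReal.ofReal (k * δ ^ (n + 1 : ℝ)) := by
  obtain ⟨κ, hκ0, hκ, h⟩ := volume_box i₀
  have hn : 1 ≤ n := i₀.pos
  set v : ℝ≥0∞ := (volume (Metric.ball (0 : Cn n) 1))⁻¹ * κ with hv
  have hvt : v ≠ ∞ := ENNReal.mul_ne_top volume_ball_inv_ne_top hκ
  have hv0 : v ≠ 0 := mul_ne_zero volume_ball_inv_ne_zero hκ0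
  have hvr : 0 < v.toReal := ENNReal.toReal_pos hv0 hvt
  refine ⟨v.toReal * (η ^ 2 * (η ^ 2) ^ (n - 1)), by positivity, fun δ hδ c hsub => ?_⟩
  rw [normVol, Measure.smul_apply, Measure.restrict_apply (measurableSet_box _ _ _ _),
    Set.inter_eq_left.2 hsub, h c _ _ (by positivity) (by positivity), smul_eq_mul, ← mul_assoc,
    ← hv, mul_assoc v.toReal, ENNReal.ofReal_mul hvr.le, ENNReal.ofReal_toReal hvt]
  congr 2
  have e : δ ^ (n + 1 : ℝ) = δ ^ 2 * δ ^ (n - 1) := by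
    rw [← pow_add, ← Real.rpow_natCast]
    congr 1
    have : 2 + (n - 1) = n + 1 := by omega
    rw [this]; push_cast; ring
  rw [e, mul_pow, mul_pow, Real.sq_sqrt hδ.le, mul_pow]
  ring

/-- The exponent of the kernel is at most the critical one. -/
theorem HasTestBound.exponent (hn : 1 ≤ n) {a b c p q α β : ℝ} (hp : 0 < p) (hq : 0 < q)
    (hα : -1 < α) (hβ : -1 < β) (h : HasTestBound n a b c p q α β) :
    c ≤ n + 1 + a + b + (n + 1 + β) / q - (n + 1 + α) / p := by
  obtain ⟨ε, hε, hε2, C, hC, h⟩ := h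
  have hn0 : (1 : ℝ) ≤ n := by exact_mod_cast hn
  let i₀ : Fin n := ⟨0, hn⟩
  -- This η gives nη ≤ 1 and 4η ≤ ε; with δ ≤ ε, the error δ(δ + 4η) is then at most ε·2δ.
  set η : ℝ := ε / (4 * n) with hη
  have hη0 : 0 < η := by positivity
  have hnη : n * η = ε / 4 := by rw [hη]; field_simp
  have hηε : 4 * η ≤ ε := by nlinarith
  obtain ⟨k, hk, hvol⟩ := exists_normVol_box i₀ hη0
  set wα := weightConst n α with hwα
  set wβ := weightConst n β with hwβ
  have hwα0 : 0 < wα := weightConst_pos hα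
  have hwβ0 : 0 < wβ := weightConst_pos hβ
  -- The total power of 1 - |z|² in the q-th power of the norm of the outer weight.
  set e : ℝ := β + a * q with he
  set A : ℝ := 2 ^ (-c) * (3 ^ (-|b|) * k) * (wβ * (3 ^ (-|e|) * k)) ^ (1 / q) with hA
  set B : ℝ := C.toReal * (wα * (3 ^ |α| * k)) ^ (1 / p) with hB
  have hA0 : 0 < A := by positivity
  -- Power counting on the box: 1 - |u|² is comparable to δ, its volume to δ^(n+1), and 1 - ⟨z,u⟩ is
  -- close to d = 2δ.
  have key : ∀ δ : ℝ, 0 < δ → δ ≤ ε →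
      A * δ ^ (-c + (b + (n + 1)) + (e + (n + 1)) * (1 / q)) ≤
        B * δ ^ ((α + (n + 1)) * (1 / p)) := by
    intro δ hδ hδε
    set E : Set (Cn n) := box i₀ ((1 - δ : ℝ) : ℂ) (η * δ) (η * Real.sqrt δ) with hE
    have hEm : MeasurableSet E := measurableSet_box _ _ _ _
    have hclose : ∀ z ∈ E, ∀ u ∈ E, ‖1 - inner ℂ u z - (2 * δ : ℝ)‖ ≤ ε * (2 * δ) := by
      intro z hz u hu
      refine (norm_one_sub_inner_sub_le_of_mem_box i₀ hη0 (by linarith) (by linarith) hδ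
        (by linarith) hz hu).trans ?_
      nlinarith
    have hdelta : ∀ u ∈ E, δ ≤ 1 - ‖u‖ ^ 2 ∧ 1 - ‖u‖ ^ 2 ≤ 3 * δ := by
      intro u hu
      have h1 := hclose u hu u hu
      rw [inner_self_eq_norm_sq_to_K] at h1
      have h2 : (1 : ℂ) - ((‖u‖ : ℝ) : ℂ) ^ 2 - (2 * δ : ℝ) = ((1 - ‖u‖ ^ 2 - 2 * δ : ℝ) : ℂ) := by
        push_cast; ring
      have h3 : |1 - ‖u‖ ^ 2 - 2 * δ| ≤ ε * (2 * δ) := by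
        rw [← Real.norm_eq_abs, ← Complex.norm_real, ← h2]
        exact h1
      -- This uses ε ≤ 1/2 and confines 1 - |u|² to [δ, 3δ].
      have h4 : ε * (2 * δ) ≤ δ := by nlinarith
      rw [abs_le] at h3
      constructor <;> linarith [h3.1, h3.2]
    have hEball : E ⊆ Metric.ball 0 1 := by
      intro u hu
      have := (hdelta u hu).1
      rw [mem_ball_zero_iff]
      nlinarith [norm_nonneg u]
    have hvolE : normVol n E = ENNReal.ofReal (k * δ ^ (n + 1 : ℝ)) := hvol δ hδ _ hEball
    have htest : TestData ε E (E.indicator (1 : Cn n → ℝ≥0∞)) (2 * δ) :=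
      { measurableSet := hEm
        subset_ball := hEball
        measurable := measurable_one.indicator hEm
        ne_top := fun u => by
          by_cases hu : u ∈ E
          · rw [Set.indicator_of_mem hu]; simp
          · rw [Set.indicator_of_notMem hu]; simp
        mem_ball := fun u hu => hEball (Set.mem_of_indicator_ne_zero hu)
        pos := by positivity
        close := fun z hz u hu => by
          have hu' : u ∈ E := Set.mem_of_indicator_ne_zero hu
          have h2δ : ((2 * δ : ℝ) : ℂ) ≠ 0 := by
            exact_mod_cast (show (2 * δ : ℝ) ≠ 0 by positivity)
          rw [div_sub_one h2δ, norm_div, Complex.norm_real, Real.norm_of_nonneg (by positivity),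
            div_le_iff₀ (by positivity)]
          exact hclose z hz u hu' }
    have hb := h E _ _ htest (lwNorm_indicator_one_lt_top hn hp hα E)
    have hlow : ∀ s : ℝ, ENNReal.ofReal (3 ^ (-|s|) * δ ^ s * (k * δ ^ (n + 1 : ℝ))) ≤
        ∫⁻ u in E, wt s u ∂normVol n := by
      intro s
      rw [ENNReal.ofReal_mul (by positivity), ← hvolE, ← setLIntegral_const]
      exact setLIntegral_mono' hEm fun u hu =>
        (wt_bounds hδ (hdelta u hu).1 (hdelta u hu).2 s).1
    have hup : ∀ s : ℝ, ∫⁻ u in E, wt s u ∂normVol n ≤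
        ENNReal.ofReal (3 ^ |s| * δ ^ s * (k * δ ^ (n + 1 : ℝ))) := by
      intro s
      rw [ENNReal.ofReal_mul (by positivity), ← hvolE, ← setLIntegral_const]
      exact setLIntegral_mono' hEm fun u hu =>
        (wt_bounds hδ (hdelta u hu).1 (hdelta u hu).2 s).2
    have hI : ∫⁻ u, wt b u * E.indicator 1 u ∂normVol n = ∫⁻ u in E, wt b u ∂normVol n := by
      rw [← lintegral_indicator hEm]
      refine lintegral_congr fun u => ?_
      by_cases hu : u ∈ E <;> simp [hu]
    have hQ : ENNReal.ofReal ((wβ * (3 ^ (-|e|) * δ ^ e * (k * δ ^ (n + 1 : ℝ)))) ^ (1 / q)) ≤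
        lwNorm q β (E.indicator (wt a)) := by
      rw [lwNorm, lintegral_weightedVol hβ (((measurable_wt a).indicator hEm).pow_const q),
        ← ENNReal.ofReal_rpow_of_nonneg (by positivity) (by positivity),
        ENNReal.ofReal_mul hwβ0.le]
      gcongr
      refine (hlow e).trans (le_of_eq ?_)
      rw [← lintegral_indicator hEm]
      refine lintegral_congr fun u => ?_
      by_cases hu : u ∈ E
      · rw [Set.indicator_of_mem hu, Set.indicator_of_mem hu, wt_rpow (hEball hu),
          wt_mul_wt (hEball hu)]
      · rw [Set.indicator_of_notMem hu, Set.indicator_of_notMem hu, ENNReal.zero_rpow_of_pos hq,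
          mul_zero]
    have hP : lwNorm p α (E.indicator 1) ≤
        ENNReal.ofReal ((wα * (3 ^ |α| * δ ^ α * (k * δ ^ (n + 1 : ℝ)))) ^ (1 / p)) := by
      rw [lwNorm, lintegral_weightedVol hα ((measurable_one.indicator hEm).pow_const p),
        ← ENNReal.ofReal_rpow_of_nonneg (by positivity) (by positivity),
        ENNReal.ofReal_mul hwα0.le]
      gcongr
      refine (le_of_eq ?_).trans (hup α)
      rw [← lintegral_indicator hEm]
      refine lintegral_congr fun u => ?_
      by_cases hu : u ∈ E
      · simp [hu]
      · rw [Set.indicator_of_notMem hu, Set.indicator_of_notMem hu, ENNReal.zero_rpow_of_pos hp,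
          mul_zero]
    have hfinal : ENNReal.ofReal ((2 * δ) ^ (-c) * (3 ^ (-|b|) * δ ^ b * (k * δ ^ (n + 1 : ℝ))) *
        (wβ * (3 ^ (-|e|) * δ ^ e * (k * δ ^ (n + 1 : ℝ)))) ^ (1 / q)) ≤
        ENNReal.ofReal (C.toReal *
          (wα * (3 ^ |α| * δ ^ α * (k * δ ^ (n + 1 : ℝ)))) ^ (1 / p)) := by
      rw [ENNReal.ofReal_mul (by positivity), ENNReal.ofReal_mul (by positivity),
        ENNReal.ofReal_mul (p := C.toReal) ENNReal.toReal_nonneg, ENNReal.ofReal_toReal hC]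
      refine le_trans ?_ (hb.trans (mul_le_mul_right hP C))
      rw [testValue, hI]
      gcongr
      exact hlow b
    rw [ENNReal.ofReal_le_ofReal_iff (by positivity)] at hfinal
    have hcomb : ∀ (w m s r : ℝ), 0 ≤ w → 0 ≤ m →
        (w * (m * δ ^ s * (k * δ ^ (n + 1 : ℝ)))) ^ r =
          (w * (m * k)) ^ r * δ ^ ((s + (n + 1)) * r) := by
      intro w m s r hw hm
      rw [Real.rpow_mul hδ.le, ← Real.mul_rpow (by positivity) (by positivity), Real.rpow_add hδ s]
      congr 1; ring
    rw [hcomb _ _ _ _ hwβ0.le (by positivity), hcomb _ _ _ _ hwα0.le (by positivity),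
      Real.mul_rpow zero_le_two hδ.le] at hfinal
    calc _ = 2 ^ (-c) * δ ^ (-c) * (3 ^ (-|b|) * δ ^ b * (k * δ ^ (n + 1 : ℝ))) *
          ((wβ * (3 ^ (-|e|) * k)) ^ (1 / q) * δ ^ ((e + (n + 1)) * (1 / q))) := by
          rw [Real.rpow_add hδ, Real.rpow_add hδ, Real.rpow_add hδ b, hA]; ring
      _ ≤ _ := hfinal
      _ = _ := by rw [hB]; ring
  have hexp := le_of_forall_mul_rpow_le hA0 hε key
  have e1 : (e + (n + 1)) * (1 / q) = a + (n + 1 + β) / q := by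
    rw [he]; field_simp; ring
  have e2 : (α + (n + 1)) * (1 / p) = (n + 1 + α) / p := by ring
  rw [e1, e2] at hexp
  linarith

/-! ### The equivalence for nearly positive kernels and the theorem -/

theorem isBoundedOp_iff (hn : 1 ≤ n) {a b c p q α β : Fin 2 → ℝ} (hp : ∀ i, 1 < p i)
    (hpq : ∀ i, p i ≤ q i) (hα : ∀ i, -1 < α i) (hβ : ∀ i, -1 < β i)
    {K : Cn n × Cn n → Cn n × Cn n → ℂ} (hK : IsNearlyPositiveKernel b c K) :
    IsBoundedOp a K p α q β ↔
      ∀ i, CoordCond n (a i) (b i) (c i) (p i) (q i) (α i) (β i) := by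
  refine ⟨fun h i => ?_, fun h => isBoundedOp_of_coordCond hn hp hpq hα hβ h hK⟩
  have hp0 : ∀ i, 0 < p i := fun i => by linarith [hp i]
  have hq0 : ∀ i, 0 < q i := fun i => by linarith [hp i, hpq i]
  have ht := hasTestBound_of_isBoundedOp hn hp0 hq0 hα hβ hK h i
  exact ⟨ht.outer_weight hn (hp0 i) (hq0 i) (hα i) (hβ i), ht.inner_weight hn (hp i) (hq0 i) (hα i) (hβ i),
    ht.exponent hn (hp0 i) (hq0 i) (hα i) (hβ i)⟩

end ForelliRudin

theorem theorem1p1 (n : ℕ) (hn : 1 ≤ n) (a b c p q α β : Fin 2 → ℝ)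
    (hp : 1 < min (p 0) (p 1))
    (hpq : max (p 0) (p 1) ≤ min (q 0) (q 1))
    (hα : ∀ i, -1 < α i) (hβ : ∀ i, -1 < β i) :
    (ForelliRudin.SBounded n a b c p α q β ↔ ForelliRudin.TBounded n a b c p α q β) ∧
    (ForelliRudin.TBounded n a b c p α q β ↔
      ∀ i, -(q i * a i) < β i + 1 ∧ α i + 1 < p i * (b i + 1) ∧
        c i ≤ n + 1 + a i + b i + (n + 1 + β i) / q i - (n + 1 + α i) / p i) := by
  rw [lt_min_iff] at hp
  rw [max_le_iff, le_min_iff, le_min_iff] at hpq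
  have hp' : ∀ i, 1 < p i := fun i => by fin_cases i; exacts [hp.1, hp.2]
  have hpq' : ∀ i, p i ≤ q i := fun i => by fin_cases i; exacts [hpq.1.1, hpq.2.2]
  have hS := ForelliRudin.isBoundedOp_iff hn hp' hpq' hα hβ
    (ForelliRudin.isNearlyPositiveKernel_kernelS (n := n) b c) (a := a)
  have hT := ForelliRudin.isBoundedOp_iff hn hp' hpq' hα hβ
    (ForelliRudin.isNearlyPositiveKernel_kernelT (n := n) b c) (a := a)
  exact ⟨hS.trans hT.symm, hT⟩
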